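/- Let $n$ be a natural number and $I\subseteq\{1,\dots,n\}$. Let $Q_n$ be the quiver with vertices $1,\dots,n$, one loop at each vertex, and one arrow in each direction between $v$ and $v+1$ for $1\le v<n$; let $Q_{n,I}$ be obtained from $Q_n$ by deleting the loop at each vertex $i\in I$ (so $Q_{n,\emptyset}=Q_n$). Put $m=2n-1-|I|$. Number the loops and the pairs of opposite arrows of $Q_{n,I}$ by $1,\dots,m$ from left to right (the loop at $v$ lies between the pair joining $v-1,v$ and the pair joining $v,v+1$). If number $i$ is a loop, let $a_i$ be that loop and $b_i$ the lazy path at its vertex; otherwise let $a_i\colon v\to v+1$ and $b_i\colon v+1\to v$ be the two arrows of the pair. Compose paths from left to right, and set $\mathsf{x}_i=a_ib_i$, $\mathsf{x}_i'=b_ia_i$. For a finite quiver $Q$, let $\mathbb{C}\langle\langle Q\rangle\rangle$ be the complete path algebra, whose elements are the possibly infinite linear combinations of paths. A potential is a possibly infinite linear combination of cyclic paths. Two potentials $W,W'$ are cyclically equivalent, $W\sim W'$, if $W-W'$ lies in the closure of the linear span of all commutators $pq-qp$ with $p,q\in\mathbb{C}\langle\langle Q\rangle\rangle$. The Jacobi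 algebra $\mathcal{J}\mathrm{ac}(Q,W)$ is the quotient of $\mathbb{C}\langle\langle Q\rangle\rangle$ by the closure of the two-sided ideal generated by the cyclic derivatives $\partial_aW$ for all arrows $a$. Closures are taken in the $\mathfrak{m}$-adic topology, where $\mathfrak{m}$ is the ideal generated by the arrows. A monomialized Type $A$ potential on $Q_{n,I}$ is a potential $f$ with $$f\sim\sum_{i=1}^{m-1}\mathsf{x}_i'\mathsf{x}_{i+1}+\sum_{i=1}^{m}\sum_{j=2}^{\infty}\kappa'_{ij}\mathsf{x}_i^{j}\qquad\text{for some }\kappa'_{ij}\in\mathbb{C}.$$ **Proposition.** For every monomialized Type $A$ potential $f$ on $Q_{n,I}$ there are $\kappa_{ij}\in\mathbb{C}$ such that the (possibly non-reduced) monomialized Type $A$ potential $$g=\sum_{i=1}^{2n-2}\mathsf{x}_i'\mathsf{x}_{i+1}+\sum_{i=1}^{2n-1}\sum_{j=2}^{\infty}\kappa_{ij}\mathsf{x}_i^{j}$$ on $Q_n$ satisfies $\mathcal{J}\mathrm{ac}(Q_n,g)\cong\mathcal{J}\mathrm{ac}(Q_{n,I},f)$ as $\mathbb{C}$-algebras,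 and $\kappa_{2i-1,2}\neq0$ for each $i\in I$ (this is the coefficient in $g$ of the square of the loop at vertex $i$). -/

import Mathlib

universe u v w

/-! ### Complete path algebras -/

namespace Quiver.Path

variable {V : Type u} [Quiver.{v} V]

/-- All the ways of writing a path `p` as `q` followed by `r` (either may be a lazy path). -/
def splits {i : V} : ∀ {j : V}, Path i j → List (Σ x : V, Path i x × Path x j)
  | _, .nil => [⟨i, .nil, .nil⟩]
  | j, .cons p e =>
      (splits p).map (fun s => ⟨s.1, s.2.1, s.2.2.cons e⟩) ++ [⟨j, p.cons e, .nil⟩]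

theorem mem_splits {i j : V} (p : Path i j) (s : Σ x : V, Path i x × Path x j) :
    s ∈ splits p ↔ s.2.1.comp s.2.2 = p := by
  induction p with
  | nil =>
    obtain ⟨x, q, r⟩ := s
    simp only [splits, List.mem_singleton]
    constructor
    · intro h
      cases h
      rfl
    · intro h
      have hl := congrArg Path.length h
      simp only [length_comp, length_nil] at hl
      cases r with
      | nil =>
        simp only [comp_nil] at h
        rw [h]
      | cons r e => simp at hl
  | cons p e ih =>
    obtain ⟨x, q, r⟩ := s
    simp only [splits, List.mem_append, List.mem_map, List.mem_singleton]
    constructor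
    · rintro (⟨s, hs, h⟩ | h)
      · have h' := (ih s).1 hs
        cases h
        simp only [comp_cons, h']
      · cases h
        rfl
    · intro h
      cases r with
      | nil =>
        right
        simp only [comp_nil] at h
        rw [h]
      | cons r e' =>
        left
        simp only [comp_cons, cons.injEq] at h
        obtain ⟨h1, h2, h3⟩ := h
        subst h1
        cases h3
        exact ⟨⟨x, q, r⟩, (ih _).2 (eq_of_heq h2), rfl⟩

theorem splits_nodup {i j : V} (p : Path i j) : (splits p).Nodup := by
  induction p with
  | nil => simp [splits]
  | cons p e ih =>
    simp only [splits]
    refine List.Nodup.append (ih.map ?_) (List.nodup_singleton _) ?_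
    · rintro ⟨x, q, r⟩ ⟨x', q', r'⟩ h
      simp only [Sigma.mk.injEq] at h
      obtain ⟨h1, h2⟩ := h
      subst h1
      simpa using h2
    · intro s hs hs'
      simp only [List.mem_map, List.mem_singleton] at hs hs'
      obtain ⟨t, -, rfl⟩ := hs
      have := congrArg (fun s : (Σ x : V, Path _ x × Path x _) => s.2.2.length) hs'
      simp at this

theorem length_of_mem_splits {i j : V} {p : Path i j} {s : Σ x : V, Path i x × Path x j}
    (h : s ∈ splits p) : s.2.1.length + s.2.2.length = p.length := by
  rw [← (mem_splits p s).1 h, length_comp]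

theorem sum_splits_assoc {M : Type*} [AddCommMonoid M] {i j : V} (p : Path i j)
    (F : ∀ x y : V, Path i x → Path x y → Path y j → M) :
    ((splits p).map fun s => ((splits s.2.1).map fun t => F t.1 s.1 t.2.1 t.2.2 s.2.2).sum).sum
      = ((splits p).map fun s =>
          ((splits s.2.2).map fun t => F s.1 t.1 s.2.1 t.2.1 t.2.2).sum).sum := by
  induction p with
  | nil => simp [splits]
  | cons p e ih =>
    have h := ih (fun x y q r t => F x y q r (t.cons e))
    simp only [splits, List.map_append, List.map_map, Function.comp_def, List.sum_append,
      List.map_cons, List.map_nil, List.sum_cons, List.sum_nil, add_zero, List.sum_map_add, h,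
      add_assoc]

end Quiver.Path

/-- The complete path algebra `k⟨⟨Q⟩⟩` of a quiver with finite vertex set `V`: its elements are the
possibly infinite `k`-linear combinations of paths, `f i j p` being the coefficient of the path
`p : i ⟶ ⋯ ⟶ j`. -/
def CompletePathAlgebra (k : Type w) (V : Type u) [Quiver.{v} V] : Type (max u v w) :=
  ∀ i j : V, Quiver.Path i j → k

namespace CompletePathAlgebra

open Quiver

variable {k : Type w} [CommRing k] {V : Type u} [Quiver.{v} V]

instance : AddCommGroup (CompletePathAlgebra k V) :=
  inferInstanceAs (AddCommGroup (∀ i j : V, Path i j → k))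

instance : Module k (CompletePathAlgebra k V) :=
  inferInstanceAs (Module k (∀ i j : V, Path i j → k))

@[ext] theorem ext {k : Type w} {V : Type u} [Quiver.{v} V] {f g : CompletePathAlgebra k V}
    (h : ∀ (i j : V) (p : Path i j), f i j p = g i j p) : f = g :=
  funext fun i => funext fun j => funext fun p => h i j p

@[simp] theorem zero_apply (i j : V) (p : Path i j) :
    (0 : CompletePathAlgebra k V) i j p = 0 := rfl

@[simp] theorem add_apply (f g : CompletePathAlgebra k V) (i j : V) (p : Path i j) :
    (f + g) i j p = f i j p + g i j p := rfl

@[simp] theorem neg_apply (f : CompletePathAlgebra k V) (i j : V) (p : Path i j) :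
    (-f) i j p = -f i j p := rfl

@[simp] theorem sub_apply (f g : CompletePathAlgebra k V) (i j : V) (p : Path i j) :
    (f - g) i j p = f i j p - g i j p := rfl

@[simp] theorem smul_apply (c : k) (f : CompletePathAlgebra k V) (i j : V) (p : Path i j) :
    (c • f) i j p = c * f i j p := rfl

/-- The unit is the sum of all lazy paths. -/
instance : One (CompletePathAlgebra k V) where
  one := fun _ _ p => match p with
    | .nil => 1
    | .cons _ _ => 0

/-- The bilinear continuous extension of concatenation of paths. -/
instance : Mul (CompletePathAlgebra k V) where
  mul f g := fun i j p => ((Path.splits p).map fun s => f i s.1 s.2.1 * g s.1 j s.2.2).sum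

@[simp] theorem one_nil (i : V) : (1 : CompletePathAlgebra k V) i i Path.nil = 1 := rfl

@[simp] theorem one_cons (i j l : V) (p : Path i j) (e : j ⟶ l) :
    (1 : CompletePathAlgebra k V) i l (p.cons e) = 0 := rfl

theorem mul_apply (f g : CompletePathAlgebra k V) (i j : V) (p : Path i j) :
    (f * g) i j p = ((Path.splits p).map fun s => f i s.1 s.2.1 * g s.1 j s.2.2).sum := rfl

theorem mul_nil (f g : CompletePathAlgebra k V) (i : V) :
    (f * g) i i Path.nil = f i i Path.nil * g i i Path.nil := by
  rw [mul_apply]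
  exact add_zero _

theorem mul_cons (f g : CompletePathAlgebra k V) (i j l : V) (p : Path i j) (e : j ⟶ l) :
    (f * g) i l (p.cons e) =
      ((Path.splits p).map fun s => f i s.1 s.2.1 * g s.1 l (s.2.2.cons e)).sum +
        f i l (p.cons e) * g l l Path.nil := by
  rw [mul_apply]
  simp only [Path.splits, List.map_append, List.map_map, Function.comp_def, List.sum_append,
    List.map_cons, List.map_nil, List.sum_cons, List.sum_nil, add_zero]

private theorem mul_one' (f : CompletePathAlgebra k V) : f * 1 = f := by
  ext i j p
  cases p with
  | nil => rw [mul_nil, one_nil, mul_one]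
  | cons p e => simp only [mul_cons, one_cons, one_nil, mul_zero, mul_one]; simp

private theorem one_mul' (f : CompletePathAlgebra k V) : 1 * f = f := by
  ext i j p
  induction p generalizing f with
  | nil => rw [mul_nil, one_nil, one_mul]
  | @cons b c p e ih =>
    classical
    let g : CompletePathAlgebra k V :=
      fun x y q => if hy : y = b then f x c ((hy ▸ q : Path x b).cons e) else 0
    have h := ih g
    rw [mul_apply] at h
    simp only [g, dif_pos] at h
    rw [mul_cons, one_cons, zero_mul, add_zero, h]

private theorem mul_assoc' (f g h : CompletePathAlgebra k V) : f * g * h = f * (g * h) := by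
  ext i j p
  simp only [mul_apply, ← List.sum_map_mul_right, ← List.sum_map_mul_left, mul_assoc]
  exact Path.sum_splits_assoc p
    (fun x y q r t => f i x q * (g x y r * h y j t))

instance : Ring (CompletePathAlgebra k V) :=
  { (inferInstance : AddCommGroup (CompletePathAlgebra k V)),
    (inferInstance : Mul (CompletePathAlgebra k V)),
    (inferInstance : One (CompletePathAlgebra k V)) with
    mul_assoc := mul_assoc'
    one_mul := one_mul'
    mul_one := mul_one'
    zero_mul := fun f => by ext; simp [mul_apply]
    mul_zero := fun f => by ext; simp [mul_apply]
    left_distrib := fun f g h => by ext; simp [mul_apply, mul_add, List.sum_map_add]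
    right_distrib := fun f g h => by ext; simp [mul_apply, add_mul, List.sum_map_add] }

instance : Algebra k (CompletePathAlgebra k V) :=
  Algebra.ofModule
    (fun c f g => by ext; simp [mul_apply, mul_assoc, List.sum_map_mul_left])
    (fun c f g => by ext; simp [mul_apply, mul_left_comm, List.sum_map_mul_left])

open Classical in
/-- A path, as an element of the complete path algebra. -/
noncomputable def ofPath (k : Type w) [CommRing k] {i j : V} (p : Path i j) :
    CompletePathAlgebra k V := fun x y q =>
  if (⟨x, y, q⟩ : Σ x y : V, Path x y) = ⟨i, j, p⟩ then 1 else 0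

/-- The lazy path `e_i` at the vertex `i`. -/
noncomputable def lazy (k : Type w) [CommRing k] (i : V) : CompletePathAlgebra k V :=
  ofPath k (Path.nil : Path i i)

/-- An arrow, as an element of the complete path algebra. -/
noncomputable def arrow (k : Type w) [CommRing k] {i j : V} (a : i ⟶ j) :
    CompletePathAlgebra k V :=
  ofPath k a.toPath

/-- `f` and `g` are congruent modulo the paths of length at least `N`; when the quiver is finite,
this says `f - g ∈ 𝔪 ^ N`, where `𝔪` is the two-sided ideal generated by the arrows. -/
def AgreeBelow (N : ℕ) (f g : CompletePathAlgebra k V) : Prop :=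
  ∀ (i j : V) (p : Path i j), p.length < N → f i j p = g i j p

theorem AgreeBelow.mul {N : ℕ} {f f' g g' : CompletePathAlgebra k V} (hf : AgreeBelow N f f')
    (hg : AgreeBelow N g g') : AgreeBelow N (f * g) (f' * g') := by
  intro i j p hp
  simp only [mul_apply]
  congr 1
  refine List.map_congr_left fun s hs => ?_
  have := Path.length_of_mem_splits hs
  rw [hf _ _ _ (by omega), hg _ _ _ (by omega)]

/-- The closure of a subset of the complete path algebra for the `𝔪`-adic topology. -/
def adicClosure (S : Set (CompletePathAlgebra k V)) : Set (CompletePathAlgebra k V) :=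
  {f | ∀ N : ℕ, ∃ g ∈ S, AgreeBelow N f g}

/-- The closure of a two-sided ideal, which is again a two-sided ideal. -/
def closureIdeal (J : TwoSidedIdeal (CompletePathAlgebra k V)) :
    TwoSidedIdeal (CompletePathAlgebra k V) :=
  TwoSidedIdeal.mk' (adicClosure {f | f ∈ J})
    (fun _ => ⟨0, J.zero_mem, fun _ _ _ _ => rfl⟩)
    (fun {f g} hf hg N => by
      obtain ⟨f', hf', h1⟩ := hf N
      obtain ⟨g', hg', h2⟩ := hg N
      exact ⟨f' + g', J.add_mem hf' hg', fun i j p hp => by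
        simp [h1 i j p hp, h2 i j p hp]⟩)
    (fun {f} hf N => by
      obtain ⟨f', hf', h1⟩ := hf N
      exact ⟨-f', J.neg_mem hf', fun i j p hp => by simp [h1 i j p hp]⟩)
    (fun {f g} hg N => by
      obtain ⟨g', hg', h2⟩ := hg N
      exact ⟨f * g', J.mul_mem_left _ _ hg', AgreeBelow.mul (fun _ _ _ _ => rfl) h2⟩)
    (fun {f g} hf N => by
      obtain ⟨f', hf', h1⟩ := hf N
      exact ⟨f' * g, J.mul_mem_right _ _ hf', AgreeBelow.mul h1 (fun _ _ _ _ => rfl)⟩)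

/-- A potential is a possibly infinite linear combination of cyclic paths. -/
def IsPotential (W : CompletePathAlgebra k V) : Prop :=
  ∀ (i j : V) (p : Path i j), W i j p ≠ 0 → i = j

/-- Cyclic equivalence: `W - W'` lies in the closure of the span of the commutators. -/
def CyclicallyEquivalent (W W' : CompletePathAlgebra k V) : Prop :=
  W - W' ∈ adicClosure
    {f | f ∈ Submodule.span k {c | ∃ p q : CompletePathAlgebra k V, c = p * q - q * p}}

open Classical in
/-- The cyclic derivative along an arrow `a : i ⟶ j`, the continuous linear extension of
`a₁ ⋯ a_d ↦ ∑_{l : a_l = a} a_{l+1} ⋯ a_d a₁ ⋯ a_{l-1}`. Here a path `p` from `j` to `i` arises once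
from each splitting `p = q r`, namely from the cycle `r a q` and this occurrence of `a` in it. -/
noncomputable def cyclicDerivative {i j : V} (a : i ⟶ j) (W : CompletePathAlgebra k V) :
    CompletePathAlgebra k V := fun x y p =>
  if h : x = j ∧ y = i then
    ((Path.splits (p.cast h.1 h.2)).map fun s => W s.1 s.1 ((s.2.2.cons a).comp s.2.1)).sum
  else 0

/-- The Jacobi ideal: the closure of the two-sided ideal generated by all cyclic derivatives. -/
noncomputable def jacobiIdeal (W : CompletePathAlgebra k V) :
    TwoSidedIdeal (CompletePathAlgebra k V) :=
  closureIdeal (TwoSidedIdeal.span {f | ∃ (i j : V) (a : i ⟶ j), f = cyclicDerivative a W})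

/-- The Jacobi algebra `Jac(Q, W) = k⟨⟨Q⟩⟩ / J(W)`. -/
abbrev JacobiAlgebra (W : CompletePathAlgebra k V) : Type (max u v w) :=
  (jacobiIdeal W).ringCon.Quotient

/-- The infinite sum `∑_{l ≥ 2} c l • x ^ l`, for `x` without constant terms. As `x ^ l` then has
only paths of length at least `l`, the coefficient of a path `p` involves only `l ≤ length p`. -/
def seriesFromTwo (c : ℕ → k) (x : CompletePathAlgebra k V) : CompletePathAlgebra k V :=
  fun i j p => ∑ l ∈ Finset.Icc 2 p.length, c l * (x ^ l) i j p

end CompletePathAlgebra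

/-! ### The quivers `Q_{n,I}` and monomialized Type A potentials -/

namespace TypeA

open CompletePathAlgebra

/-- The vertices `1, …, n` of `Q_{n,I}`. -/
def Vertex (n : ℕ) (_I : Finset ℕ) : Type := {v : ℕ // v ∈ Finset.Icc 1 n}

/-- The arrows of `Q_{n,I}`: a loop at each vertex outside `I`, and arrows in both directions
between any two neighbouring vertices. -/
inductive Arrow (n : ℕ) (I : Finset ℕ) : Vertex n I → Vertex n I → Type
  | loop (v : Vertex n I) (hv : v.1 ∉ I) : Arrow n I v v
  | right (v w : Vertex n I) (h : v.1 + 1 = w.1) : Arrow n I v w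
  | left (v w : Vertex n I) (h : v.1 + 1 = w.1) : Arrow n I w v

instance (n : ℕ) (I : Finset ℕ) : Quiver (Vertex n I) := ⟨Arrow n I⟩

/-- The index set of the elements `x_i`: the loops, and the edges between neighbouring vertices. -/
inductive Slot (n : ℕ) (I : Finset ℕ) : Type
  | loop (v : Vertex n I) (hv : v.1 ∉ I) : Slot n I
  | edge (v w : Vertex n I) (h : v.1 + 1 = w.1) : Slot n I

variable {n : ℕ} {I : Finset ℕ}

/-- The position of a slot from left to right: its index when no loop has been removed. -/
def Slot.position : Slot n I → ℕ
  | .loop v _ => 2 * v.1 - 1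
  | .edge v _ _ => 2 * v.1

theorem Slot.position_lt (s : Slot n I) : s.position < 2 * n + 1 := by
  cases s with
  | loop v hv => have := Finset.mem_Icc.1 v.2; simp only [position]; omega
  | edge v w h => have := Finset.mem_Icc.1 v.2; simp only [position]; omega

theorem Slot.position_injective : Function.Injective (Slot.position (n := n) (I := I)) := by
  intro s t h
  cases s with
  | loop v hv =>
    have h1 := Finset.mem_Icc.1 v.2
    cases t with
    | loop v' hv' =>
      have h2 := Finset.mem_Icc.1 v'.2
      simp only [position] at h
      obtain rfl : v = v' := Subtype.ext (by omega)
      rfl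
    | edge v' w' h' =>
      have h2 := Finset.mem_Icc.1 v'.2
      simp only [position] at h
      omega
  | edge v w hvw =>
    have h1 := Finset.mem_Icc.1 v.2
    cases t with
    | loop v' hv' =>
      have h2 := Finset.mem_Icc.1 v'.2
      simp only [position] at h
      omega
    | edge v' w' h' =>
      simp only [position] at h
      obtain rfl : v = v' := Subtype.ext (by omega)
      obtain rfl : w = w' := Subtype.ext (by omega)
      rfl

noncomputable instance : Fintype (Slot n I) :=
  Fintype.ofInjective (fun s : Slot n I => (⟨s.position, s.position_lt⟩ : Fin (2 * n + 1)))
    (fun _ _ h => Slot.position_injective (Fin.mk.inj h))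

/-- The index `i` of `x_i` in `Q_{n,I}`: the slots are numbered `1, …, m` from left to right. -/
noncomputable def Slot.label (s : Slot n I) : ℕ :=
  (Finset.univ.filter fun t : Slot n I => t.position ≤ s.position).card

/-- The element `a_i`: a loop, or an arrow pointing right. -/
noncomputable def Slot.a : Slot n I → CompletePathAlgebra ℂ (Vertex n I)
  | .loop v hv => arrow ℂ (i := v) (j := v) (Arrow.loop v hv)
  | .edge v w h => arrow ℂ (i := v) (j := w) (Arrow.right v w h)

/-- The element `b_i`: the lazy path if `a_i` is a loop, else the arrow opposite to `a_i`. -/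
noncomputable def Slot.b : Slot n I → CompletePathAlgebra ℂ (Vertex n I)
  | .loop v _ => lazy ℂ v
  | .edge v w h => arrow ℂ (i := w) (j := v) (Arrow.left v w h)

/-- `x_i = a_i b_i`. -/
noncomputable def Slot.x (s : Slot n I) : CompletePathAlgebra ℂ (Vertex n I) := s.a * s.b

/-- `x_i' = b_i a_i`. -/
noncomputable def Slot.x' (s : Slot n I) : CompletePathAlgebra ℂ (Vertex n I) := s.b * s.a

/-- The potential `∑_{i=1}^{m-1} x_i' x_{i+1} + ∑_{i=1}^{m} ∑_{j ≥ 2} κ i j • x_i ^ j` on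
`Q_{n,I}`. -/
noncomputable def monomialPotential (n : ℕ) (I : Finset ℕ) (κ : ℕ → ℕ → ℂ) :
    CompletePathAlgebra ℂ (Vertex n I) :=
  (∑ s : Slot n I, ∑ t : Slot n I with t.label = s.label + 1, s.x' * t.x) +
    ∑ s : Slot n I, seriesFromTwo (κ s.label) s.x

/-- A monomialized Type A potential on `Q_{n,I}`. -/
def IsMonomializedTypeA (n : ℕ) (I : Finset ℕ) (f : CompletePathAlgebra ℂ (Vertex n I)) : Prop :=
  IsPotential f ∧ ∃ κ : ℕ → ℕ → ℂ, CyclicallyEquivalent f (monomialPotential n I κ)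

end TypeA

/-! ### Splittings of paths -/

namespace Quiver.Path

variable {V : Type u} [Quiver.{v} V]

/-! At a vertex `v` of `I`, give the loop `a` of `Q_n` the term `-(1/2) a ^ 2` and no other powers.
Write `b` for `backAt (v - 1)` and `o` for `outAt v`, the cycles at `v` through its left and right
neighbours. The part of `g` involving `a` is then `b a + a o - (1/2) a ^ 2`, so `∂_a g = b + o - a`:
the Jacobi relation solves for the loop, `a = b + o`, and the loop can be eliminated.

This substitution completes the square. Up to commutators the part becomes `b o + (1/2) b ^ 2 +
(1/2) o ^ 2`. The term `b o` is exactly the product of neighbours that `Q_{n,I}` acquires when the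
loop between them is deleted. The squares are unwanted, but the two cycles along one edge have
cyclically equivalent squares, so lowering the quadratic coefficient of an edge by `1/2` for each of
its endpoints in `I` cancels them. The remaining coefficients are those of `f`, moved to the
matching positions (`liftedCoeff`, `algHom_lifted_sub_mem`).

`nonempty_jacobiAlgebra_algEquiv` passes to Jacobi algebras. Let `φ` be the substitution and `ι` the
inclusion of the smaller quiver. Then `φ ∘ ι` is the identity, and `ι ∘ φ` is the identity modulo
the Jacobi ideal of `g`. By the chain rule `Substitution.polarDerivative_algHom`, `∂_c φ(g)` is
`φ(∂_{ι c} g)` plus terms containing `φ(∂_a g)` for eliminated loops `a`, and these vanish. Hence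
`φ` and `ι` carry the Jacobi ideals into each other. Cyclic equivalence preserves cyclic
derivatives, so `f` may stand for `φ(g)`.

The chain rule is proved for `polarDerivative`, a cyclic derivative with a second argument inserted
in the gap, because this version obeys a Leibniz rule. Infinite sums are handled by continuity:
linear identities are checked on paths and extended. -/

theorem splits_cons_comp {i j l : V} (p : Path i j) (e : j ⟶ l) {m : V} (r : Path l m) :
    splits ((p.cons e).comp r) =
      (splits p).map (fun s => ⟨s.1, s.2.1, (s.2.2.cons e).comp r⟩) ++
        (splits r).map (fun s => ⟨s.1, (p.cons e).comp s.2.1, s.2.2⟩) := by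
  induction r with
  | nil => simp [splits]
  | cons r e' ih =>
    rw [comp_cons]
    simp only [splits, ih, List.map_append, List.map_map, Function.comp_def, List.append_assoc,
      List.map_cons, List.map_nil, comp_cons]

theorem sum_splits_eq_of_left {M : Type*} [AddCommMonoid M] {i j : V} (p : Path i j)
    (F : (Σ x : V, Path i x × Path x j) → M) (hF : ∀ s, s.2.1.length ≠ 0 → F s = 0) :
    ((splits p).map F).sum = F ⟨i, nil, p⟩ := by
  induction p with
  | nil => simp [splits]
  | @cons b c p e ih =>
    have h := ih (fun s => F ⟨s.1, s.2.1, s.2.2.cons e⟩) (fun s hs => hF _ hs)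
    simp only [splits, List.map_append, List.map_map, Function.comp_def, List.sum_append,
      List.map_cons, List.map_nil, List.sum_cons, List.sum_nil, add_zero, h]
    rw [hF ⟨c, p.cons e, nil⟩ (by simp), add_zero]

theorem sum_splits_eq_of_right {M : Type*} [AddCommMonoid M] {i j : V} (p : Path i j)
    (F : (Σ x : V, Path i x × Path x j) → M) (hF : ∀ s, s.2.2.length ≠ 0 → F s = 0) :
    ((splits p).map F).sum = F ⟨j, p, nil⟩ := by
  cases p with
  | nil => simp [splits]
  | cons p e =>
    simp only [splits, List.map_append, List.map_map, Function.comp_def, List.sum_append,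
      List.map_cons, List.map_nil, List.sum_cons, List.sum_nil, add_zero]
    rw [List.sum_eq_zero, zero_add]
    intro x hx
    obtain ⟨s, -, rfl⟩ := List.mem_map.1 hx
    exact hF _ (by simp)

theorem finite_length_lt [Finite V] [∀ i j : V, Finite (i ⟶ j)] (N : ℕ) (i j : V) :
    {p : Path i j | p.length < N}.Finite := by
  induction N generalizing j with
  | zero => simp
  | succ N ih =>
    have h0 : {p : Path i j | p.length = 0}.Finite := by
      refine Set.Subsingleton.finite ?_
      rintro (_ | ⟨p, e⟩) hp q hq
      · cases q with
        | nil => rfl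
        | cons q e => simp at hq
      · simp at hp
    refine (h0.union (Set.finite_iUnion fun l : V => (ih l).image2 (fun p (e : l ⟶ j) => p.cons e)
      Set.finite_univ)).subset ?_
    rintro (_ | ⟨p, e⟩) hp
    · left; simp
    · right
      simp only [Set.mem_ofPred_eq, length_cons] at hp
      exact Set.mem_iUnion.2 ⟨_, p, by simp; omega, e, trivial, rfl⟩

end Quiver.Path

theorem List.sum_map_sum_comm {α β M : Type*} [AddCommMonoid M] (l : List α) (l' : List β)
    (F : α → β → M) :
    (l.map fun a => (l'.map fun b => F a b).sum).sum =
      (l'.map fun b => (l.map fun a => F a b).sum).sum := by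
  induction l with
  | nil => simp
  | cons a l ih => simp [ih, List.sum_map_add]

namespace CompletePathAlgebra

open Quiver

variable {k : Type w} {V : Type u} [Quiver.{v} V]

/-! ### The adic topology -/

theorem AgreeBelow.refl (N : ℕ) (f : CompletePathAlgebra k V) : AgreeBelow N f f :=
  fun _ _ _ _ => rfl

theorem AgreeBelow.symm {N : ℕ} {f g : CompletePathAlgebra k V} (h : AgreeBelow N f g) :
    AgreeBelow N g f := fun i j p hp => (h i j p hp).symm

theorem AgreeBelow.trans {N : ℕ} {f g h : CompletePathAlgebra k V} (h₁ : AgreeBelow N f g)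
    (h₂ : AgreeBelow N g h) : AgreeBelow N f h :=
  fun i j p hp => (h₁ i j p hp).trans (h₂ i j p hp)

theorem AgreeBelow.mono {M N : ℕ} (h : M ≤ N) {f g : CompletePathAlgebra k V}
    (hf : AgreeBelow N f g) : AgreeBelow M f g := fun i j p hp => hf i j p (by omega)

theorem eq_of_agreeBelow {f g : CompletePathAlgebra k V} (h : ∀ N, AgreeBelow N f g) : f = g :=
  ext fun i j p => h (p.length + 1) i j p (by omega)

theorem subset_adicClosure (S : Set (CompletePathAlgebra k V)) : S ⊆ adicClosure S :=
  fun f hf N => ⟨f, hf, AgreeBelow.refl N f⟩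

theorem adicClosure_adicClosure (S : Set (CompletePathAlgebra k V)) :
    adicClosure (adicClosure S) = adicClosure S := by
  refine Set.Subset.antisymm (fun f hf N => ?_) (subset_adicClosure _)
  obtain ⟨g, hg, h⟩ := hf N
  obtain ⟨g', hg', h'⟩ := hg N
  exact ⟨g', hg', h.trans h'⟩

theorem adicClosure_mono {S T : Set (CompletePathAlgebra k V)} (h : S ⊆ T) :
    adicClosure S ⊆ adicClosure T := fun _ hf N =>
  let ⟨g, hg, hfg⟩ := hf N
  ⟨g, h hg, hfg⟩

/-- Continuity, for the adic topologies, of an additive map. -/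
def AdicContinuous {V' : Type*} [Quiver V'] (T : CompletePathAlgebra k V → CompletePathAlgebra k V') :
    Prop := ∀ N, ∃ M, ∀ f g, AgreeBelow M f g → AgreeBelow N (T f) (T g)

theorem AdicContinuous.adicClosure_preimage {V' : Type*} [Quiver V']
    {T : CompletePathAlgebra k V → CompletePathAlgebra k V'} (hT : AdicContinuous T)
    {S : Set (CompletePathAlgebra k V')} (hS : adicClosure S ⊆ S) :
    adicClosure (T ⁻¹' S) ⊆ T ⁻¹' S := by
  intro f hf
  refine hS fun N => ?_
  obtain ⟨M, hM⟩ := hT N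
  obtain ⟨g, hg, hfg⟩ := hf M
  exact ⟨T g, hg, hM f g hfg⟩

theorem adicContinuous_id : AdicContinuous (id : CompletePathAlgebra k V → _) :=
  fun N => ⟨N, fun _ _ h => h⟩

theorem adicContinuous_const {V' : Type*} [Quiver V'] (a : CompletePathAlgebra k V') :
    AdicContinuous fun _ : CompletePathAlgebra k V => a :=
  fun N => ⟨0, fun _ _ _ => AgreeBelow.refl N a⟩

theorem AdicContinuous.comp {V' V'' : Type*} [Quiver V'] [Quiver V'']
    {T : CompletePathAlgebra k V → CompletePathAlgebra k V'}
    {T' : CompletePathAlgebra k V' → CompletePathAlgebra k V''}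
    (hT' : AdicContinuous T') (hT : AdicContinuous T) : AdicContinuous fun f => T' (T f) := by
  intro N
  obtain ⟨M, hM⟩ := hT' N
  obtain ⟨M', hM'⟩ := hT M
  exact ⟨M', fun f g h => hM _ _ (hM' _ _ h)⟩

variable [CommRing k]

theorem AgreeBelow.add {N : ℕ} {f f' g g' : CompletePathAlgebra k V} (hf : AgreeBelow N f f')
    (hg : AgreeBelow N g g') : AgreeBelow N (f + g) (f' + g') :=
  fun i j p hp => by simp [hf i j p hp, hg i j p hp]

theorem AgreeBelow.sub {N : ℕ} {f f' g g' : CompletePathAlgebra k V} (hf : AgreeBelow N f f')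
    (hg : AgreeBelow N g g') : AgreeBelow N (f - g) (f' - g') :=
  fun i j p hp => by simp [hf i j p hp, hg i j p hp]

theorem adicClosure_singleton_zero :
    adicClosure ({0} : Set (CompletePathAlgebra k V)) ⊆ {0} := by
  intro f hf
  refine eq_of_agreeBelow fun N => ?_
  obtain ⟨g, rfl, h⟩ := hf N
  exact h

/-! ### Paths as elements of the algebra -/

theorem ofPath_self {i j : V} (p : Path i j) : ofPath k p i j p = 1 := if_pos rfl

theorem ofPath_of_ne {i j x y : V} {p : Path i j} {q : Path x y}
    (h : (⟨x, y, q⟩ : Σ x y : V, Path x y) ≠ ⟨i, j, p⟩) : ofPath k p x y q = 0 := if_neg h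

theorem ofPath_of_length_ne {i j x y : V} {p : Path i j} {q : Path x y}
    (h : q.length ≠ p.length) : ofPath k p x y q = 0 :=
  ofPath_of_ne fun h' => h (congrArg (fun s : Σ x y : V, Path x y => s.2.2.length) h')

open Classical in
theorem lazy_nil (i x : V) : lazy k i x x Path.nil = if x = i then 1 else 0 := by
  split_ifs with h
  · subst h; exact ofPath_self _
  · exact ofPath_of_ne fun h' => h (congrArg Sigma.fst h')

open Classical in
theorem lazy_mul_apply (i : V) (f : CompletePathAlgebra k V) (x y : V) (p : Path x y) :
    (lazy k i * f) x y p = if x = i then f x y p else 0 := by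
  rw [mul_apply, Path.sum_splits_eq_of_left]
  · simp [lazy_nil]
  · intro s hs
    rw [lazy, ofPath_of_length_ne (by simpa using hs), zero_mul]

open Classical in
theorem mul_lazy_apply (i : V) (f : CompletePathAlgebra k V) (x y : V) (p : Path x y) :
    (f * lazy k i) x y p = if y = i then f x y p else 0 := by
  rw [mul_apply, Path.sum_splits_eq_of_right]
  · simp [lazy_nil]
  · intro s hs
    rw [lazy, ofPath_of_length_ne (by simpa using hs), mul_zero]

theorem lazy_mul_self (i : V) : lazy k i * lazy k i = lazy k i := by
  ext x y p
  rw [lazy_mul_apply]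
  split_ifs with h
  · rfl
  · exact (ofPath_of_ne fun h' => h (congrArg Sigma.fst h')).symm

theorem lazy_mul_of_ne {i j : V} (h : i ≠ j) : lazy k i * lazy k j = 0 := by
  ext x y p
  rw [lazy_mul_apply]
  split_ifs with h'
  · subst h'
    exact ofPath_of_ne fun h' => h (congrArg Sigma.fst h')
  · rfl

theorem lazy_mul_ofPath {i j : V} (p : Path i j) : lazy k i * ofPath k p = ofPath k p := by
  ext x y q
  rw [lazy_mul_apply]
  split_ifs with h
  · rfl
  · exact (ofPath_of_ne fun h' => h (congrArg Sigma.fst h')).symm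

theorem ofPath_mul_lazy {i j : V} (p : Path i j) : ofPath k p * lazy k j = ofPath k p := by
  ext x y q
  rw [mul_lazy_apply]
  split_ifs with h
  · rfl
  · exact (ofPath_of_ne fun h' => h (congrArg (fun s => s.2.1) h')).symm

theorem ofPath_mul_arrow {i j l : V} (p : Path i j) (e : j ⟶ l) :
    ofPath k p * arrow k e = ofPath k (p.cons e) := by
  ext x y q
  cases q with
  | nil =>
    rw [mul_nil, arrow, ofPath_of_length_ne (p := e.toPath) (by simp), mul_zero,
      ofPath_of_length_ne (by simp)]
  | @cons b c q e' =>
    rw [mul_cons, arrow, ofPath_of_length_ne (p := e.toPath) (q := Path.nil) (by simp), mul_zero,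
      add_zero, Path.sum_splits_eq_of_right]
    · by_cases h : (⟨x, y, q.cons e'⟩ : Σ x y : V, Path x y) = ⟨i, l, p.cons e⟩
      · cases h
        rw [ofPath_self, ofPath_self]
        simpa using! ofPath_self (k := k) e.toPath
      · rw [ofPath_of_ne h]
        by_cases h' : (⟨b, y, Path.nil.cons e'⟩ : Σ x y : V, Path x y) = ⟨j, l, e.toPath⟩
        · cases h'
          rw [ofPath_of_ne (p := p), zero_mul]
          intro h''
          cases h''
          exact h rfl
        · rw [ofPath_of_ne h', mul_zero]
    · intro s hs
      rw [ofPath_of_length_ne (p := e.toPath) (by simpa using hs), mul_zero]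

theorem ofPath_mul_ofPath {i j l : V} (p : Path i j) (q : Path j l) :
    ofPath k p * ofPath k q = ofPath k (p.comp q) := by
  induction q with
  | nil => exact ofPath_mul_lazy p
  | cons q e ih => rw [← ofPath_mul_arrow, ← mul_assoc, ih, ofPath_mul_arrow, Path.comp_cons]

theorem ofPath_mul_ofPath_of_ne {i j l m : V} (h : j ≠ l) (p : Path i j) (q : Path l m) :
    ofPath k p * ofPath k q = 0 := by
  rw [← ofPath_mul_lazy p, ← lazy_mul_ofPath q, mul_assoc, ← mul_assoc (lazy k j),
    lazy_mul_of_ne h, zero_mul, mul_zero]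

theorem sum_lazy [Fintype V] : ∑ i : V, lazy k i = 1 := by
  classical
  -- The factor `1` makes `lazy_mul_apply` available: `lazy k i` on the left keeps the paths
  -- starting at `i`, and each path starts at exactly one vertex.
  calc ∑ i : V, lazy k i = ∑ i : V, lazy k i * 1 := by simp
    _ = 1 := by
      ext x y p
      have h : ∀ s : Finset V, (∑ i ∈ s, lazy k i * 1) x y p =
          ∑ i ∈ s, (lazy k i * 1) x y p := fun s => by
        induction s using Finset.induction_on with
        | empty => rfl
        | insert a s ha ih => rw [Finset.sum_insert ha, Finset.sum_insert ha, add_apply, ih]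
      rw [h]
      simp_rw [lazy_mul_apply]
      simp

theorem AdicContinuous.add {V' : Type*} [Quiver V']
    {T T' : CompletePathAlgebra k V → CompletePathAlgebra k V'}
    (hT : AdicContinuous T) (hT' : AdicContinuous T') : AdicContinuous fun f => T f + T' f := by
  intro N
  obtain ⟨M, hM⟩ := hT N
  obtain ⟨M', hM'⟩ := hT' N
  exact ⟨max M M', fun f g h => (hM _ _ (h.mono (le_max_left _ _))).add
    (hM' _ _ (h.mono (le_max_right _ _)))⟩

theorem AdicContinuous.sub {V' : Type*} [Quiver V']
    {T T' : CompletePathAlgebra k V → CompletePathAlgebra k V'}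
    (hT : AdicContinuous T) (hT' : AdicContinuous T') : AdicContinuous fun f => T f - T' f := by
  intro N
  obtain ⟨M, hM⟩ := hT N
  obtain ⟨M', hM'⟩ := hT' N
  exact ⟨max M M', fun f g h => (hM _ _ (h.mono (le_max_left _ _))).sub
    (hM' _ _ (h.mono (le_max_right _ _)))⟩

theorem adicContinuous_mul_left (a : CompletePathAlgebra k V) :
    AdicContinuous fun f : CompletePathAlgebra k V => a * f :=
  fun N => ⟨N, fun _ _ h => (AgreeBelow.refl N a).mul h⟩

theorem adicContinuous_mul_right (a : CompletePathAlgebra k V) :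
    AdicContinuous fun f : CompletePathAlgebra k V => f * a :=
  fun N => ⟨N, fun _ _ h => h.mul (AgreeBelow.refl N a)⟩

theorem adicContinuous_sum {V' ι : Type*} [Quiver V'] (s : Finset ι)
    {T : ι → CompletePathAlgebra k V → CompletePathAlgebra k V'}
    (hT : ∀ i, AdicContinuous (T i)) : AdicContinuous fun f => ∑ i ∈ s, T i f := by
  classical
  induction s using Finset.induction_on with
  | empty => simpa using! adicContinuous_const 0
  | insert a s ha ih => simpa [Finset.sum_insert ha] using! (hT a).add ih

theorem sum_apply {ι : Type*} (s : Finset ι) (F : ι → CompletePathAlgebra k V) (x y : V)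
    (p : Path x y) : (∑ i ∈ s, F i) x y p = ∑ i ∈ s, F i x y p := by
  classical
  induction s using Finset.induction_on with
  | empty => rfl
  | insert a s ha ih => rw [Finset.sum_insert ha, Finset.sum_insert ha, add_apply, ih]

/-! ### Density of the finite combinations of paths -/

section Finite

variable [Finite V] [∀ i j : V, Finite (i ⟶ j)]

theorem finite_paths_length_lt (N : ℕ) :
    {p : Σ i j : V, Path i j | p.2.2.length < N}.Finite := by
  have := Set.finite_iUnion fun i : V => Set.finite_iUnion fun j : V =>
    (Path.finite_length_lt N i j).image fun p => (⟨i, j, p⟩ : Σ i j : V, Path i j)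
  refine this.subset ?_
  rintro ⟨i, j, p⟩ hp
  exact Set.mem_iUnion.2 ⟨i, Set.mem_iUnion.2 ⟨j, p, hp, rfl⟩⟩

/-- The paths of length less than `N`. -/
noncomputable def pathsBelow (V : Type u) [Quiver.{v} V] [Finite V] [∀ i j : V, Finite (i ⟶ j)]
    (N : ℕ) : Finset (Σ i j : V, Path i j) := (finite_paths_length_lt N).toFinset

@[simp] theorem mem_pathsBelow {N : ℕ} {p : Σ i j : V, Path i j} :
    p ∈ pathsBelow V N ↔ p.2.2.length < N := by simp [pathsBelow]

/-- A closed subspace containing all paths is everything. -/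
theorem mem_of_forall_ofPath_mem {S : Submodule k (CompletePathAlgebra k V)}
    (hS : adicClosure (S : Set (CompletePathAlgebra k V)) ⊆ S)
    (h : ∀ (i j : V) (p : Path i j), ofPath k p ∈ S) (f : CompletePathAlgebra k V) : f ∈ S := by
  classical
  -- The truncation of `f` below length `N` is a finite sum because the quiver is finite.
  refine hS fun N => ⟨∑ p ∈ pathsBelow V N, f p.1 p.2.1 p.2.2 • ofPath k p.2.2,
    S.sum_mem fun p _ => S.smul_mem _ (h _ _ _), fun x y q hq => ?_⟩
  rw [sum_apply, Finset.sum_eq_single (⟨x, y, q⟩ : Σ i j : V, Path i j)]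
  · simp [ofPath_self]
  · intro p _ hp
    rw [smul_apply, ofPath_of_ne hp.symm, mul_zero]
  · intro h
    exact absurd (mem_pathsBelow.2 hq) h

/-- Two continuous linear maps which agree on paths are equal. -/
theorem eq_of_forall_ofPath_eq {V' : Type*} [Quiver V']
    {T T' : CompletePathAlgebra k V →ₗ[k] CompletePathAlgebra k V'}
    (hT : AdicContinuous T) (hT' : AdicContinuous T')
    (h : ∀ (i j : V) (p : Path i j), T (ofPath k p) = T' (ofPath k p)) : T = T' := by
  refine LinearMap.ext fun f => ?_
  have := mem_of_forall_ofPath_mem (S := LinearMap.ker (T - T'))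
    (by exact (hT.sub hT').adicClosure_preimage adicClosure_singleton_zero)
    (fun i j p => by simp [h]) f
  simpa [sub_eq_zero] using this

end Finite

end CompletePathAlgebra

namespace CompletePathAlgebra

open Quiver

variable {k : Type w} [CommRing k] {V : Type u} [Quiver.{v} V]

theorem mul_agreeBelow_zero {M N : ℕ} {f g : CompletePathAlgebra k V} (hf : AgreeBelow M f 0)
    (hg : AgreeBelow N g 0) : AgreeBelow (M + N) (f * g) 0 := by
  intro i j p hp
  rw [mul_apply, zero_apply]
  refine List.sum_eq_zero fun x hx => ?_
  obtain ⟨s, hs, rfl⟩ := List.mem_map.1 hx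
  have := Path.length_of_mem_splits hs
  rcases lt_or_ge s.2.1.length M with h | h
  · rw [hf _ _ _ h, zero_apply, zero_mul]
  · rw [hg _ _ _ (by omega), zero_apply, mul_zero]

theorem pow_agreeBelow_zero {f : CompletePathAlgebra k V} (hf : AgreeBelow 1 f 0) (l : ℕ) :
    AgreeBelow l (f ^ l) 0 := by
  induction l with
  | zero => intro i j p hp; omega
  | succ l ih => rw [pow_succ]; exact mul_agreeBelow_zero ih hf

theorem agreeBelow_one_zero_iff {f : CompletePathAlgebra k V} :
    AgreeBelow 1 f 0 ↔ ∀ i, f i i Path.nil = 0 := by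
  refine ⟨fun h i => h i i Path.nil (by simp), ?_⟩
  rintro h i j (_ | ⟨p, e⟩) hp
  · exact h i
  · simp at hp

theorem arrow_agreeBelow {i j : V} (a : i ⟶ j) : AgreeBelow 1 (arrow k a) 0 :=
  agreeBelow_one_zero_iff.2 fun _ => ofPath_of_length_ne (by simp)

/-! ### Power series -/

theorem seriesFromTwo_agreeBelow (c : ℕ → k) {x : CompletePathAlgebra k V}
    (hx : AgreeBelow 1 x 0) (N : ℕ) :
    AgreeBelow N (seriesFromTwo c x) (∑ l ∈ Finset.Icc 2 N, c l • x ^ l) := by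
  intro i j p hp
  rw [sum_apply]
  refine Finset.sum_subset (Finset.Icc_subset_Icc_right hp.le) fun l hl hl' => ?_
  simp only [Finset.mem_Icc, not_and, not_le] at hl hl'
  rw [pow_agreeBelow_zero hx l i j p (hl' hl.1), zero_apply, mul_zero]

theorem seriesFromTwo_zero (c : ℕ → k) : seriesFromTwo c (0 : CompletePathAlgebra k V) = 0 := by
  refine eq_of_agreeBelow fun N => (seriesFromTwo_agreeBelow c (AgreeBelow.refl _ _) N).trans ?_
  rw [Finset.sum_eq_zero]
  · exact AgreeBelow.refl _ _
  · intro l hl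
    rw [zero_pow (by have := Finset.mem_Icc.1 hl; omega), smul_zero]

theorem seriesFromTwo_add (c d : ℕ → k) (x : CompletePathAlgebra k V) :
    seriesFromTwo (c + d) x = seriesFromTwo c x + seriesFromTwo d x := by
  ext i j p
  simp [seriesFromTwo, add_mul, Finset.sum_add_distrib]

/-- The coefficients of the series `c t ^ 2`. -/
def quadratic (c : k) : ℕ → k := fun l => if l = 2 then c else 0

theorem seriesFromTwo_quadratic (c : k) {x : CompletePathAlgebra k V} (hx : AgreeBelow 1 x 0) :
    seriesFromTwo (quadratic c) x = c • x ^ 2 := by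
  -- Precision `N + 2` guarantees that the index `2` lies in the truncated sum.
  refine eq_of_agreeBelow fun N => AgreeBelow.mono (Nat.le_add_right N 2) ?_
  refine (seriesFromTwo_agreeBelow _ hx (N + 2)).trans ?_
  rw [Finset.sum_eq_single 2]
  · simp [quadratic, AgreeBelow.refl]
  · intro l _ hl; simp [quadratic, hl]
  · intro h; simp at h

/-! ### Continuous homomorphisms -/

/-- A bijection on vertices, and images without constant terms for the arrows. -/
structure Substitution (k : Type*) [CommRing k] (V V' : Type*) [Quiver V] [Quiver V'] where
  vertex : V ≃ V'
  image : ∀ {i j : V}, (i ⟶ j) → CompletePathAlgebra k V'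
  lazy_mul_image : ∀ {i j : V} (a : i ⟶ j), lazy k (vertex i) * image a = image a
  image_mul_lazy : ∀ {i j : V} (a : i ⟶ j), image a * lazy k (vertex j) = image a
  image_agreeBelow : ∀ {i j : V} (a : i ⟶ j), AgreeBelow 1 (image a) 0

namespace Substitution

variable {V' : Type*} [Quiver V'] (φ : Substitution k V V')

/-- The image of a path under a substitution. -/
noncomputable def path {i : V} : ∀ {j : V}, Path i j → CompletePathAlgebra k V'
  | _, .nil => lazy k (φ.vertex i)
  | _, .cons p e => path p * φ.image e

theorem path_agreeBelow {i j : V} (p : Path i j) : AgreeBelow p.length (φ.path p) 0 := by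
  induction p with
  | nil => intro i j p hp; simp at hp
  | cons p e ih => exact mul_agreeBelow_zero ih (φ.image_agreeBelow e)

theorem path_mul_lazy {i j : V} (p : Path i j) : φ.path p * lazy k (φ.vertex j) = φ.path p := by
  cases p with
  | nil => exact lazy_mul_self _
  | cons p e => rw [path, mul_assoc, φ.image_mul_lazy]

theorem lazy_mul_path {i j : V} (p : Path i j) : lazy k (φ.vertex i) * φ.path p = φ.path p := by
  induction p with
  | nil => exact lazy_mul_self _
  | cons p e ih => rw [path, ← mul_assoc, ih]

theorem path_comp {i j l : V} (p : Path i j) (q : Path j l) :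
    φ.path (p.comp q) = φ.path p * φ.path q := by
  induction q with
  | nil => exact (φ.path_mul_lazy p).symm
  | cons q e ih => rw [Path.comp_cons, path, ih, path, mul_assoc]

theorem path_mul_path_of_ne {i j l m : V} (h : j ≠ l) (p : Path i j) (q : Path l m) :
    φ.path p * φ.path q = 0 := by
  rw [← φ.path_mul_lazy p, ← φ.lazy_mul_path q, mul_assoc, ← mul_assoc (lazy k _),
    lazy_mul_of_ne (φ.vertex.injective.ne h), zero_mul, mul_zero]

variable [Finite V] [∀ i j : V, Finite (i ⟶ j)]

/-- The continuous linear extension of a substitution. -/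
noncomputable def linearMap : CompletePathAlgebra k V →ₗ[k] CompletePathAlgebra k V' where
  -- The image of a path `p` has no terms shorter than `p`, so only paths of length at most
  -- `q.length` affect the coefficient of `q`.
  toFun f x y q := ∑ p ∈ pathsBelow V (q.length + 1), f p.1 p.2.1 p.2.2 * φ.path p.2.2 x y q
  map_add' f g := by
    ext x y q
    exact (Finset.sum_congr rfl fun p _ => add_mul _ _ _).trans Finset.sum_add_distrib
  map_smul' c f := by
    ext x y q
    exact (Finset.sum_congr rfl fun p _ => mul_assoc _ _ _).trans (Finset.mul_sum _ _ _).symm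

theorem adicContinuous_linearMap : AdicContinuous φ.linearMap := by
  refine fun N => ⟨N, fun f g h x y q hq => Finset.sum_congr rfl fun p hp => ?_⟩
  rw [mem_pathsBelow] at hp
  rw [h _ _ _ (by omega)]

theorem linearMap_ofPath {i j : V} (p : Path i j) : φ.linearMap (ofPath k p) = φ.path p := by
  ext x y q
  change ∑ p' ∈ pathsBelow V (q.length + 1), _ = _
  rw [Finset.sum_eq_single (⟨i, j, p⟩ : Σ i j : V, Path i j)]
  · rw [ofPath_self, one_mul]
  · intro p' _ hp'
    rw [ofPath_of_ne hp', zero_mul]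
  · intro h
    rw [φ.path_agreeBelow p x y q (by simpa using h), zero_apply, mul_zero]

/-- Both sides are continuous and linear in each factor. Density is used twice: for the right factor
with a path on the left, then for the left factor. -/
theorem linearMap_mul (f g : CompletePathAlgebra k V) :
    φ.linearMap (f * g) = φ.linearMap f * φ.linearMap g := by
  have key : ∀ {i j : V} (p : Path i j) (g : CompletePathAlgebra k V),
      φ.linearMap (ofPath k p * g) = φ.path p * φ.linearMap g := by
    intro i j p g
    refine LinearMap.congr_fun (eq_of_forall_ofPath_eq
      (T := φ.linearMap ∘ₗ LinearMap.mulLeft k (ofPath k p))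
      (T' := LinearMap.mulLeft k (φ.path p) ∘ₗ φ.linearMap)
      (φ.adicContinuous_linearMap.comp (adicContinuous_mul_left _))
      ((adicContinuous_mul_left _).comp φ.adicContinuous_linearMap) fun l m q => ?_) g
    simp only [LinearMap.comp_apply, LinearMap.mulLeft_apply, linearMap_ofPath]
    by_cases h : j = l
    · subst h
      rw [ofPath_mul_ofPath, linearMap_ofPath, path_comp]
    · rw [ofPath_mul_ofPath_of_ne h, map_zero, φ.path_mul_path_of_ne h]
  refine LinearMap.congr_fun (eq_of_forall_ofPath_eq
    (T := φ.linearMap ∘ₗ LinearMap.mulRight k g)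
    (T' := LinearMap.mulRight k (φ.linearMap g) ∘ₗ φ.linearMap)
    (φ.adicContinuous_linearMap.comp (adicContinuous_mul_right _))
    ((adicContinuous_mul_right _).comp φ.adicContinuous_linearMap) fun l m q => ?_) f
  simp only [LinearMap.comp_apply, LinearMap.mulRight_apply, linearMap_ofPath, key]

theorem linearMap_one : φ.linearMap 1 = 1 := by
  have := Fintype.ofFinite V
  have := Fintype.ofEquiv V φ.vertex
  rw [← sum_lazy, ← sum_lazy, map_sum]
  exact Fintype.sum_equiv φ.vertex _ _ fun i => φ.linearMap_ofPath Path.nil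

/-- The continuous algebra homomorphism defined by a substitution. -/
noncomputable def algHom : CompletePathAlgebra k V →ₐ[k] CompletePathAlgebra k V' :=
  AlgHom.ofLinearMap φ.linearMap φ.linearMap_one φ.linearMap_mul

theorem adicContinuous_algHom : AdicContinuous φ.algHom := φ.adicContinuous_linearMap

theorem algHom_ofPath {i j : V} (p : Path i j) : φ.algHom (ofPath k p) = φ.path p :=
  φ.linearMap_ofPath p

theorem algHom_lazy (i : V) : φ.algHom (lazy k i) = lazy k (φ.vertex i) :=
  φ.linearMap_ofPath Path.nil

theorem algHom_arrow {i j : V} (a : i ⟶ j) : φ.algHom (arrow k a) = φ.image a :=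
  (φ.linearMap_ofPath a.toPath).trans (φ.lazy_mul_image a)

theorem algHom_agreeBelow {f : CompletePathAlgebra k V} {N : ℕ} (h : AgreeBelow N f 0) :
    AgreeBelow N (φ.algHom f) 0 := by
  intro x y q hq
  refine Finset.sum_eq_zero fun p hp => ?_
  rw [mem_pathsBelow] at hp
  rw [h _ _ _ (by omega), zero_apply, zero_mul]

/-- A substitution never lowers lengths, so modulo paths of length at least `N` the series may be
replaced by a finite sum, which any algebra homomorphism respects. -/
theorem algHom_seriesFromTwo (c : ℕ → k) {x : CompletePathAlgebra k V} (hx : AgreeBelow 1 x 0) :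
    φ.algHom (seriesFromTwo c x) = seriesFromTwo c (φ.algHom x) := by
  refine eq_of_agreeBelow fun N => ?_
  have h₁ : AgreeBelow N (seriesFromTwo c x - ∑ l ∈ Finset.Icc 2 N, c l • x ^ l) 0 := by
    simpa only [sub_self] using (seriesFromTwo_agreeBelow c hx N).sub
      (AgreeBelow.refl N (∑ l ∈ Finset.Icc 2 N, c l • x ^ l))
  have h₂ := (φ.algHom_agreeBelow h₁).add
    (AgreeBelow.refl N (∑ l ∈ Finset.Icc 2 N, c l • φ.algHom x ^ l))
  simp only [map_sub, map_sum, map_smul, map_pow, sub_add_cancel, zero_add] at h₂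
  exact h₂.trans (seriesFromTwo_agreeBelow c (φ.algHom_agreeBelow hx) N).symm

end Substitution

end CompletePathAlgebra

namespace CompletePathAlgebra

open Quiver

variable {k : Type w} [CommRing k] {V : Type u} [Quiver.{v} V]

/-! ### Cyclic derivatives -/

open Classical in
/-- The element with prescribed coefficients on the paths from `i` to `j`, and no others. -/
noncomputable def corner {i j : V} (F : Path i j → k) : CompletePathAlgebra k V := fun x y p =>
  if h : x = i ∧ y = j then F (p.cast h.1 h.2) else 0

theorem corner_apply {i j : V} (F : Path i j → k) (p : Path i j) : corner F i j p = F p := by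
  rw [corner, dif_pos ⟨rfl, rfl⟩]
  rfl

theorem corner_apply_of_ne {i j x y : V} (F : Path i j → k) (h : ¬(x = i ∧ y = j))
    (p : Path x y) : corner F x y p = 0 := dif_neg h

theorem lazy_mul_mul_lazy (i j : V) (f : CompletePathAlgebra k V) :
    lazy k i * f * lazy k j = corner (f i j) := by
  ext x y p
  rw [mul_lazy_apply]
  by_cases h : x = i ∧ y = j
  · obtain ⟨rfl, rfl⟩ := h
    rw [corner_apply, if_pos rfl, lazy_mul_apply, if_pos rfl]
  · rw [corner_apply_of_ne _ h, lazy_mul_apply]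
    split_ifs with h₁ h₂
    · exact absurd ⟨h₂, h₁⟩ h
    · rfl
    · rfl

/-- The coefficients of `polarDerivative`. -/
noncomputable def polarCoeff {i j : V} (a : i ⟶ j) (f g : CompletePathAlgebra k V)
    (c : Path j i) : k :=
  -- The path `c` is cut into `s₁ t₁ t₂`: the middle piece is read from `g`, and the outer pieces,
  -- joined through `a` as `t₂ a s₁`, from `f`.
  ((Path.splits c).map fun s => ((Path.splits s.2.2).map fun t =>
    g s.1 t.1 t.2.1 * f t.1 s.1 ((t.2.2.cons a).comp s.2.1)).sum).sum

theorem polarCoeff_add_left {i j : V} (a : i ⟶ j) (f f' g : CompletePathAlgebra k V)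
    (c : Path j i) : polarCoeff a (f + f') g c = polarCoeff a f g c + polarCoeff a f' g c := by
  simp [polarCoeff, mul_add, List.sum_map_add]

theorem polarCoeff_smul_left {i j : V} (a : i ⟶ j) (r : k) (f g : CompletePathAlgebra k V)
    (c : Path j i) : polarCoeff a (r • f) g c = r * polarCoeff a f g c := by
  simp [polarCoeff, mul_left_comm _ r, List.sum_map_mul_left]

theorem polarCoeff_add_right {i j : V} (a : i ⟶ j) (f g g' : CompletePathAlgebra k V)
    (c : Path j i) : polarCoeff a f (g + g') c = polarCoeff a f g c + polarCoeff a f g' c := by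
  simp [polarCoeff, add_mul, List.sum_map_add]

theorem polarCoeff_smul_right {i j : V} (a : i ⟶ j) (r : k) (f g : CompletePathAlgebra k V)
    (c : Path j i) : polarCoeff a f (r • g) c = r * polarCoeff a f g c := by
  simp [polarCoeff, mul_assoc, List.sum_map_mul_left]

/-- By `Path.splits_cons_comp`, the cut between `f` and `f'` lies before or after the marked arrow
`a`. In the first case the factor `f` is absorbed on the right of `g`; in the second `f'` is
absorbed on its left. Associativity of splittings matches the resulting sums. -/
theorem polarCoeff_mul {i j : V} (a : i ⟶ j) (f f' g : CompletePathAlgebra k V)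
    (c : Path j i) :
    polarCoeff a (f * f') g c = polarCoeff a f (f' * g) c + polarCoeff a f' (g * f) c := by
  have h₁ : polarCoeff a (f * f') g c =
      ((Path.splits c).map fun s => ((Path.splits s.2.2).map fun t =>
        ((Path.splits t.2.2).map fun r => g s.1 t.1 t.2.1 *
          (f t.1 r.1 r.2.1 * f' r.1 s.1 ((r.2.2.cons a).comp s.2.1))).sum).sum).sum +
      ((Path.splits c).map fun s => ((Path.splits s.2.2).map fun t =>
        ((Path.splits s.2.1).map fun r => g s.1 t.1 t.2.1 *
          (f t.1 r.1 ((t.2.2.cons a).comp r.2.1) * f' r.1 s.1 r.2.2)).sum).sum).sum := by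
    simp only [polarCoeff, mul_apply, Path.splits_cons_comp, List.map_append, List.map_map,
      Function.comp_def, List.sum_append, mul_add, List.sum_map_add, ← List.sum_map_mul_left]
  have h₂ : polarCoeff a f' (g * f) c =
      ((Path.splits c).map fun s => ((Path.splits s.2.2).map fun t =>
        ((Path.splits t.2.2).map fun r => g s.1 t.1 t.2.1 *
          (f t.1 r.1 r.2.1 * f' r.1 s.1 ((r.2.2.cons a).comp s.2.1))).sum).sum).sum := by
    simp only [polarCoeff, mul_apply, ← List.sum_map_mul_right, mul_assoc]
    congr 1
    refine List.map_congr_left fun s _ => ?_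
    exact Path.sum_splits_assoc s.2.2 fun x y q r t =>
      g s.1 x q * (f x y r * f' y s.1 ((t.cons a).comp s.2.1))
  have h₃ : polarCoeff a f (f' * g) c =
      ((Path.splits c).map fun s => ((Path.splits s.2.2).map fun t =>
        ((Path.splits s.2.1).map fun r => g s.1 t.1 t.2.1 *
          (f t.1 r.1 ((t.2.2.cons a).comp r.2.1) * f' r.1 s.1 r.2.2)).sum).sum).sum := by
    -- The splittings of the first and of the last piece are independent, so their sums may be
    -- exchanged.
    refine Eq.trans ?_ (congrArg List.sum (List.map_congr_left fun s _ =>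
      List.sum_map_sum_comm (Path.splits s.2.1) (Path.splits s.2.2) _))
    rw [Path.sum_splits_assoc c fun x y q r t => ((Path.splits t).map fun t =>
      g y t.1 t.2.1 * (f t.1 x ((t.2.2.cons a).comp q) * f' x y r)).sum]
    simp only [polarCoeff, mul_apply, ← List.sum_map_mul_right]
    congr 1
    refine List.map_congr_left fun s _ => ?_
    rw [Path.sum_splits_assoc s.2.2 fun x y q r t =>
      f' s.1 x q * g x y r * f y s.1 ((t.cons a).comp s.2.1)]
    congr 1
    refine List.map_congr_left fun t _ => congrArg _ (List.map_congr_left fun r _ => ?_)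
    ring
  rw [h₁, h₂, h₃, add_comm]

theorem polarCoeff_lazy {i j : V} (a : i ⟶ j) (l : V) (g : CompletePathAlgebra k V)
    (c : Path j i) : polarCoeff a (lazy k l) g c = 0 := by
  refine List.sum_eq_zero fun x hx => ?_
  obtain ⟨s, -, rfl⟩ := List.mem_map.1 hx
  refine List.sum_eq_zero fun x hx => ?_
  obtain ⟨t, -, rfl⟩ := List.mem_map.1 hx
  rw [lazy, ofPath_of_length_ne (by simp), mul_zero]

theorem polarCoeff_arrow {i j x y : V} (a : i ⟶ j) (e : x ⟶ y) (g : CompletePathAlgebra k V)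
    (c : Path j i) :
    polarCoeff a (arrow k e) g c = g j i c * arrow k e i j a.toPath := by
  rw [polarCoeff, Path.sum_splits_eq_of_left, Path.sum_splits_eq_of_right]
  · rfl
  · intro s hs
    rw [arrow, ofPath_of_length_ne (by simpa using hs), mul_zero]
  · intro s hs
    refine List.sum_eq_zero fun x hx => ?_
    obtain ⟨t, -, rfl⟩ := List.mem_map.1 hx
    rw [arrow, ofPath_of_length_ne (by simp; omega), mul_zero]

/-- The derivative along `a` of `f`, followed by multiplication of `g` into the gap: the continuous
bilinear extension of `(a₁ ⋯ a_d, g) ↦ ∑_{l : a_l = a} a_{l+1} ⋯ a_d g a₁ ⋯ a_{l-1}`. -/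
noncomputable def polarDerivative {i j : V} (a : i ⟶ j) :
    CompletePathAlgebra k V →ₗ[k] CompletePathAlgebra k V →ₗ[k] CompletePathAlgebra k V :=
  LinearMap.mk₂ k (fun f g => corner (polarCoeff a f g))
    (fun f f' g => by
      ext x y p
      by_cases h : x = j ∧ y = i
      · obtain ⟨rfl, rfl⟩ := h
        simp [corner_apply, polarCoeff_add_left]
      · simp [corner_apply_of_ne _ h])
    (fun r f g => by
      ext x y p
      by_cases h : x = j ∧ y = i
      · obtain ⟨rfl, rfl⟩ := h
        simp [corner_apply, polarCoeff_smul_left]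
      · simp [corner_apply_of_ne _ h])
    (fun f g g' => by
      ext x y p
      by_cases h : x = j ∧ y = i
      · obtain ⟨rfl, rfl⟩ := h
        simp [corner_apply, polarCoeff_add_right]
      · simp [corner_apply_of_ne _ h])
    (fun r f g => by
      ext x y p
      by_cases h : x = j ∧ y = i
      · obtain ⟨rfl, rfl⟩ := h
        simp [corner_apply, polarCoeff_smul_right]
      · simp [corner_apply_of_ne _ h])

theorem polarDerivative_apply {i j : V} (a : i ⟶ j) (f g : CompletePathAlgebra k V) :
    polarDerivative a f g = corner (polarCoeff a f g) := rfl

theorem polarDerivative_mul {i j : V} (a : i ⟶ j) (f f' g : CompletePathAlgebra k V) :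
    polarDerivative a (f * f') g =
      polarDerivative a f (f' * g) + polarDerivative a f' (g * f) := by
  simp only [polarDerivative_apply]
  ext x y p
  by_cases h : x = j ∧ y = i
  · obtain ⟨rfl, rfl⟩ := h
    simp only [add_apply, corner_apply, polarCoeff_mul]
  · simp [corner_apply_of_ne _ h]

theorem polarDerivative_lazy {i j : V} (a : i ⟶ j) (l : V) (g : CompletePathAlgebra k V) :
    polarDerivative a (lazy k l) g = 0 := by
  rw [polarDerivative_apply]
  ext x y p
  by_cases h : x = j ∧ y = i
  · obtain ⟨rfl, rfl⟩ := h
    rw [corner_apply, polarCoeff_lazy, zero_apply]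
  · rw [corner_apply_of_ne _ h, zero_apply]

theorem polarDerivative_arrow_self {i j : V} (a : i ⟶ j) (g : CompletePathAlgebra k V) :
    polarDerivative a (arrow k a) g = lazy k j * g * lazy k i := by
  rw [polarDerivative_apply, lazy_mul_mul_lazy]
  congr 1
  funext c
  rw [polarCoeff_arrow, arrow, ofPath_self, mul_one]

theorem polarDerivative_arrow_of_ne {i j x y : V} {a : i ⟶ j} {e : x ⟶ y}
    (h : (⟨i, j, a⟩ : Σ i j : V, (i ⟶ j)) ≠ ⟨x, y, e⟩) (g : CompletePathAlgebra k V) :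
    polarDerivative a (arrow k e) g = 0 := by
  have h' : arrow k e i j a.toPath = 0 := by
    refine ofPath_of_ne fun h' => h ?_
    cases h'
    rfl
  rw [polarDerivative_apply]
  ext x y p
  by_cases h : x = j ∧ y = i
  · obtain ⟨rfl, rfl⟩ := h
    rw [corner_apply, polarCoeff_arrow, h', mul_zero, zero_apply]
  · rw [corner_apply_of_ne _ h, zero_apply]

/-- The marked arrow is removed from `f`, which is therefore needed to one order more than `g`. -/
theorem polarDerivative_agreeBelow {i j : V} (a : i ⟶ j) {f f' g g' : CompletePathAlgebra k V}
    {N : ℕ} (hf : AgreeBelow (N + 1) f f') (hg : AgreeBelow N g g') :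
    AgreeBelow N (polarDerivative a f g) (polarDerivative a f' g') := by
  intro x y p hp
  simp only [polarDerivative_apply]
  by_cases h : x = j ∧ y = i
  · obtain ⟨rfl, rfl⟩ := h
    rw [corner_apply, corner_apply]
    refine congrArg _ (List.map_congr_left fun s hs =>
      congrArg _ (List.map_congr_left fun t ht => ?_))
    have h₁ := Path.length_of_mem_splits hs
    have h₂ := Path.length_of_mem_splits ht
    rw [hg _ _ _ (by omega), hf _ _ _ (by simp; omega)]
  · rw [corner_apply_of_ne _ h, corner_apply_of_ne _ h]

theorem adicContinuous_polarDerivative_left {i j : V} (a : i ⟶ j) (g : CompletePathAlgebra k V) :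
    AdicContinuous fun f => polarDerivative a f g :=
  fun N => ⟨N + 1, fun _ _ h => polarDerivative_agreeBelow a h (AgreeBelow.refl N g)⟩

theorem adicContinuous_polarDerivative_right {i j : V} (a : i ⟶ j)
    (f : CompletePathAlgebra k V) : AdicContinuous fun g => polarDerivative a f g :=
  fun N => ⟨N, fun _ _ h => polarDerivative_agreeBelow a (AgreeBelow.refl (N + 1) f) h⟩

theorem polarDerivative_lazy_mul {i j : V} (a : i ⟶ j) (l : V) (f g : CompletePathAlgebra k V) :
    polarDerivative a (lazy k l * f) g = polarDerivative a f (g * lazy k l) := by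
  rw [polarDerivative_mul, polarDerivative_lazy, zero_add]

theorem polarDerivative_mul_lazy {i j : V} (a : i ⟶ j) (l : V) (f g : CompletePathAlgebra k V) :
    polarDerivative a (f * lazy k l) g = polarDerivative a f (lazy k l * g) := by
  rw [polarDerivative_mul, polarDerivative_lazy, add_zero]

/-- With `1` in the gap, only the splittings with a lazy middle piece survive. -/
theorem cyclicDerivative_eq {i j : V} (a : i ⟶ j) (W : CompletePathAlgebra k V) :
    cyclicDerivative a W = polarDerivative a W 1 := by
  rw [polarDerivative_apply]
  ext x y p
  by_cases h : x = j ∧ y = i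
  · obtain ⟨rfl, rfl⟩ := h
    rw [corner_apply, cyclicDerivative, dif_pos ⟨rfl, rfl⟩]
    refine congrArg _ (List.map_congr_left fun s hs => ?_)
    rw [Path.sum_splits_eq_of_left]
    · exact (one_mul _).symm
    · rintro ⟨z, _ | ⟨q, e⟩, r⟩ ht
      · simp at ht
      · rw [one_cons, zero_mul]
  · rw [corner_apply_of_ne _ h, cyclicDerivative, dif_neg h]

/-- Cyclically equivalent potentials have the same cyclic derivatives. -/
theorem CyclicallyEquivalent.cyclicDerivative_eq {W W' : CompletePathAlgebra k V}
    (h : CyclicallyEquivalent W W') {i j : V} (a : i ⟶ j) :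
    cyclicDerivative a W = cyclicDerivative a W' := by
  have h₁ : Submodule.span k {c | ∃ p q : CompletePathAlgebra k V, c = p * q - q * p} ≤
      LinearMap.ker ((polarDerivative a).flip (1 : CompletePathAlgebra k V)) := by
    refine Submodule.span_le.2 ?_
    -- At `g = 1` the Leibniz rule is symmetric in the two factors, so commutators have zero
    -- derivative.
    rintro _ ⟨p, q, rfl⟩
    simp [polarDerivative_mul, add_comm]
  have h₂ := (adicContinuous_polarDerivative_left a 1).adicClosure_preimage
    adicClosure_singleton_zero (adicClosure_mono (fun f hf => h₁ hf) h)
  simp only [CompletePathAlgebra.cyclicDerivative_eq]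
  simpa [sub_eq_zero] using! h₂

theorem polarDerivative_pow_eq_zero {i j : V} {a : i ⟶ j} {x : CompletePathAlgebra k V}
    (hx : ∀ g, polarDerivative a x g = 0) (l : ℕ) (g : CompletePathAlgebra k V) :
    polarDerivative a (x ^ l) g = 0 := by
  induction l generalizing g with
  | zero =>
    have := polarDerivative_mul a 1 1 g
    simpa using this
  | succ l ih => rw [pow_succ, polarDerivative_mul, ih, hx, add_zero]

theorem cyclicDerivative_seriesFromTwo_eq_zero {i j : V} {a : i ⟶ j}
    {x : CompletePathAlgebra k V} (h : AgreeBelow 1 x 0) (hx : ∀ g, polarDerivative a x g = 0)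
    (c : ℕ → k) : cyclicDerivative a (seriesFromTwo c x) = 0 := by
  refine eq_of_agreeBelow fun N => ?_
  rw [cyclicDerivative_eq]
  have := polarDerivative_agreeBelow a (seriesFromTwo_agreeBelow c h (N + 1))
    (AgreeBelow.refl N 1)
  simpa [polarDerivative_pow_eq_zero hx] using this

/-! ### The chain rule -/

namespace Substitution

variable {V' : Type*} [Quiver V'] (φ : Substitution k V V') [Fintype V]
  [∀ i j : V, Fintype (i ⟶ j)]

/-- Continuity reduces to a path `f`, treated by induction. The Leibniz rule splits off the last
arrow `e`, which contributes only for `a = e`. There the derivative returns the inserted element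
between two idempotents, and `φ.image e` absorbs these. -/
theorem polarDerivative_algHom {x y : V'} (c : x ⟶ y) (f g : CompletePathAlgebra k V) :
    polarDerivative c (φ.algHom f) (φ.algHom g) =
      ∑ a : Σ i j : V, (i ⟶ j),
        polarDerivative c (φ.image a.2.2) (φ.algHom (polarDerivative a.2.2 f g)) := by
  classical
  have key : ∀ {i j : V} (p : Path i j) (g : CompletePathAlgebra k V),
      polarDerivative c (φ.path p) (φ.algHom g) =
        ∑ a : Σ i j : V, (i ⟶ j),
          polarDerivative c (φ.image a.2.2) (φ.algHom (polarDerivative a.2.2 (ofPath k p) g)) := by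
    intro i j p g
    induction p generalizing g with
    | nil =>
      rw [path, polarDerivative_lazy, Finset.sum_eq_zero]
      intro a _
      rw [← lazy, polarDerivative_lazy, map_zero, map_zero]
    | @cons l m p e ih =>
      simp only [← ofPath_mul_arrow, path, polarDerivative_mul, map_add, Finset.sum_add_distrib]
      congr 1
      · rw [← ih, map_mul φ.algHom, algHom_arrow]
      · rw [Finset.sum_eq_single (⟨l, m, e⟩ : Σ i j : V, (i ⟶ j)), polarDerivative_arrow_self,
          map_mul φ.algHom, map_mul φ.algHom, algHom_lazy, algHom_lazy,
          ← polarDerivative_lazy_mul, φ.lazy_mul_image, ← polarDerivative_mul_lazy,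
          φ.image_mul_lazy, map_mul φ.algHom, algHom_ofPath]
        · intro a _ ha
          rw [polarDerivative_arrow_of_ne ha, map_zero, map_zero]
        · intro h
          exact absurd (Finset.mem_univ _) h
  refine LinearMap.congr_fun (eq_of_forall_ofPath_eq
    (T := (polarDerivative c).flip (φ.algHom g) ∘ₗ φ.algHom.toLinearMap)
    (T' := ∑ a : Σ i j : V, (i ⟶ j), polarDerivative c (φ.image a.2.2) ∘ₗ φ.algHom.toLinearMap ∘ₗ
      (polarDerivative a.2.2).flip g)
    ((adicContinuous_polarDerivative_left c _).comp φ.adicContinuous_algHom) ?_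
    fun i j p => ?_) f |>.trans ?_
  · intro N
    obtain ⟨M, hM⟩ := adicContinuous_sum Finset.univ (fun a : Σ i j : V, (i ⟶ j) =>
      (adicContinuous_polarDerivative_right c (φ.image a.2.2)).comp
        (φ.adicContinuous_algHom.comp (adicContinuous_polarDerivative_left a.2.2 g))) N
    exact ⟨M, fun f f' h => by simpa using! hM f f' h⟩
  · simpa [algHom_ofPath] using key p g
  · simp

end Substitution

end CompletePathAlgebra

/-! ### Isomorphisms between quotients by two-sided ideals -/

namespace TwoSidedIdeal

variable {k A B : Type*} [CommRing k] [Ring A] [Algebra k A] [Ring B] [Algebra k B]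

/-- The homomorphism of quotient algebras induced by an algebra homomorphism. -/
def quotientMap (I : TwoSidedIdeal A) (J : TwoSidedIdeal B) (f : A →ₐ[k] B)
    (h : ∀ x ∈ I, f x ∈ J) : I.ringCon.Quotient →ₐ[k] J.ringCon.Quotient :=
  { I.ringCon.lift (J.ringCon.mk'.comp f.toRingHom) (fun x y hxy => by
      have := h _ ((I.rel_iff x y).1 hxy)
      rw [map_sub] at this
      exact (RingCon.eq _).2 ((J.rel_iff _ _).2 this)) with
    commutes' := fun r => congrArg J.ringCon.mk' (f.commutes r) }

/-- Algebra homomorphisms which are inverse to each other modulo ideals induce an isomorphism of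
the quotients. -/
def quotientEquiv (I : TwoSidedIdeal A) (J : TwoSidedIdeal B) (f : A →ₐ[k] B)
    (g : B →ₐ[k] A) (hf : ∀ x ∈ I, f x ∈ J) (hg : ∀ y ∈ J, g y ∈ I)
    (hgf : ∀ x, g (f x) - x ∈ I) (hfg : ∀ y, f (g y) - y ∈ J) :
    I.ringCon.Quotient ≃ₐ[k] J.ringCon.Quotient :=
  AlgEquiv.ofAlgHom (quotientMap I J f hf) (quotientMap J I g hg)
    (AlgHom.ext fun y => by
      obtain ⟨y, rfl⟩ := J.ringCon.mk'_surjective y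
      exact (RingCon.eq _).2 ((J.rel_iff _ _).2 (hfg y)))
    (AlgHom.ext fun x => by
      obtain ⟨x, rfl⟩ := I.ringCon.mk'_surjective x
      exact (RingCon.eq _).2 ((I.rel_iff _ _).2 (hgf x)))

end TwoSidedIdeal

namespace CompletePathAlgebra

open Quiver

variable {k : Type w} [CommRing k] {V : Type u} [Quiver.{v} V]

/-! ### Jacobi ideals -/

theorem mem_closureIdeal {J : TwoSidedIdeal (CompletePathAlgebra k V)}
    {f : CompletePathAlgebra k V} : f ∈ closureIdeal J ↔ f ∈ adicClosure {f | f ∈ J} :=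
  TwoSidedIdeal.mem_mk' _ _ _ _ _ _ _

theorem cyclicDerivative_mem_jacobiIdeal (W : CompletePathAlgebra k V) {i j : V} (a : i ⟶ j) :
    cyclicDerivative a W ∈ jacobiIdeal W :=
  mem_closureIdeal.2 (subset_adicClosure _ (TwoSidedIdeal.subset_span ⟨i, j, a, rfl⟩))

theorem adicClosure_jacobiIdeal (W : CompletePathAlgebra k V) :
    adicClosure {f | f ∈ jacobiIdeal W} ⊆ {f | f ∈ jacobiIdeal W} := by
  intro f hf
  refine mem_closureIdeal.2 ?_
  rw [← adicClosure_adicClosure]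
  exact adicClosure_mono (fun g hg => mem_closureIdeal.1 hg) hf

/-- A continuous homomorphism maps one Jacobi ideal into another if it does so for the
generators. -/
theorem map_mem_jacobiIdeal {V' : Type*} [Quiver V'] {W : CompletePathAlgebra k V}
    {W' : CompletePathAlgebra k V'} {T : CompletePathAlgebra k V →ₐ[k] CompletePathAlgebra k V'}
    (hT : AdicContinuous T)
    (h : ∀ {i j : V} (a : i ⟶ j), T (cyclicDerivative a W) ∈ jacobiIdeal W')
    {f : CompletePathAlgebra k V} (hf : f ∈ jacobiIdeal W) : T f ∈ jacobiIdeal W' := by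
  refine hT.adicClosure_preimage (adicClosure_jacobiIdeal W')
    (adicClosure_mono (fun g hg => ?_) (mem_closureIdeal.1 hf))
  have : TwoSidedIdeal.span {f | ∃ (i j : V) (a : i ⟶ j), f = cyclicDerivative a W} ≤
      (jacobiIdeal W').comap T := by
    rw [TwoSidedIdeal.span_le]
    rintro _ ⟨i, j, a, rfl⟩
    exact (TwoSidedIdeal.mem_comap _).2 (h a)
  exact (TwoSidedIdeal.mem_comap _).1 (this hg)

/-- Only paths from `j` to `i` occur in this derivative. The identity removes the idempotents that
the chain rule leaves behind. -/
theorem lazy_mul_cyclicDerivative_mul_lazy {i j : V} (a : i ⟶ j) (W : CompletePathAlgebra k V) :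
    lazy k j * cyclicDerivative a W * lazy k i = cyclicDerivative a W := by
  rw [lazy_mul_mul_lazy, cyclicDerivative_eq, polarDerivative_apply]
  congr 1
  funext p
  rw [corner_apply]

/-! ### Substitution and inclusion as inverse maps modulo the Jacobi ideal -/

namespace Substitution

variable {V' : Type*} [Quiver V'] (φ : Substitution k V V')

/-- The substitution which embeds a quiver with the same vertices and fewer arrows. -/
noncomputable def embedding (φ : Substitution k V V')
    (ι : ∀ {i j : V'}, (i ⟶ j) → (φ.vertex.symm i ⟶ φ.vertex.symm j)) : Substitution k V' V where
  vertex := φ.vertex.symm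
  image a := arrow k (ι a)
  lazy_mul_image a := lazy_mul_ofPath (ι a).toPath
  image_mul_lazy a := ofPath_mul_lazy (ι a).toPath
  image_agreeBelow a := arrow_agreeBelow (ι a)

variable [Finite V] [∀ i j : V, Finite (i ⟶ j)] [Finite V'] [∀ i j : V', Finite (i ⟶ j)]
  (ι : ∀ {i j : V'}, (i ⟶ j) → (φ.vertex.symm i ⟶ φ.vertex.symm j))

theorem algHom_algHom_embedding
    (hι : ∀ {i j : V'} (a : i ⟶ j), φ.image (ι a) = arrow k a) (f : CompletePathAlgebra k V') :
    φ.algHom ((φ.embedding ι).algHom f) = f := by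
  refine LinearMap.congr_fun (eq_of_forall_ofPath_eq
    (T := φ.algHom.toLinearMap ∘ₗ (φ.embedding ι).algHom.toLinearMap) (T' := LinearMap.id)
    (φ.adicContinuous_algHom.comp (φ.embedding ι).adicContinuous_algHom) adicContinuous_id
    fun i j p => ?_) f
  change φ.algHom ((φ.embedding ι).algHom (ofPath k p)) = ofPath k p
  induction p with
  | nil =>
    rw [← lazy, algHom_lazy, algHom_lazy]
    exact congrArg _ (φ.vertex.apply_symm_apply i)
  | cons p e ih =>
    rw [← ofPath_mul_arrow, map_mul (φ.embedding ι).algHom, map_mul φ.algHom, ih, algHom_arrow]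
    exact congrArg _ ((φ.algHom_arrow (ι e)).trans (hι e))

/-- The elements fixed modulo the Jacobi ideal form a closed subspace, so paths suffice, and these
are built up arrow by arrow. -/
theorem algHom_embedding_algHom_sub_mem (W : CompletePathAlgebra k V)
    (h : ∀ {i j : V} (a : i ⟶ j),
      (φ.embedding ι).algHom (φ.image a) - arrow k a ∈ jacobiIdeal W)
    (f : CompletePathAlgebra k V) :
    (φ.embedding ι).algHom (φ.algHom f) - f ∈ jacobiIdeal W := by
  let T : CompletePathAlgebra k V →ₐ[k] CompletePathAlgebra k V :=
    (φ.embedding ι).algHom.comp φ.algHom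
  have hT : AdicContinuous T :=
    (φ.embedding ι).adicContinuous_algHom.comp φ.adicContinuous_algHom
  let S : Submodule k (CompletePathAlgebra k V) :=
    { carrier := {f | T f - f ∈ jacobiIdeal W}
      add_mem' := fun {f g} hf hg => by
        have := (jacobiIdeal W).add_mem hf hg
        rw [Set.mem_ofPred_eq, map_add, add_sub_add_comm]
        exact this
      zero_mem' := by
        rw [Set.mem_ofPred_eq, map_zero, sub_zero]
        exact (jacobiIdeal W).zero_mem
      smul_mem' := fun c f hf => by
        have := (jacobiIdeal W).mul_mem_left (algebraMap k _ c) _ hf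
        rw [Set.mem_ofPred_eq, map_smul, ← smul_sub, Algebra.smul_def]
        exact this }
  refine mem_of_forall_ofPath_mem (S := S)
    ((hT.sub adicContinuous_id).adicClosure_preimage (adicClosure_jacobiIdeal W))
    (fun i j p => ?_) f
  change T (ofPath k p) - ofPath k p ∈ jacobiIdeal W
  induction p with
  | nil =>
    have : T (ofPath k (Path.nil : Path i i)) = ofPath k (Path.nil : Path i i) := by
      change (φ.embedding ι).algHom (φ.algHom (lazy k i)) = lazy k i
      rw [algHom_lazy, algHom_lazy]
      exact congrArg _ (φ.vertex.symm_apply_apply i)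
    rw [this, sub_self]
    exact (jacobiIdeal W).zero_mem
  | @cons l m p e ih =>
    have he : T (arrow k e) - arrow k e ∈ jacobiIdeal W := by
      change (φ.embedding ι).algHom (φ.algHom (arrow k e)) - arrow k e ∈ jacobiIdeal W
      rw [algHom_arrow]
      exact h e
    -- Uses `T(p e) - p e = T(p) (T(e) - e) + (T(p) - p) e`.
    have := (jacobiIdeal W).add_mem ((jacobiIdeal W).mul_mem_left (T (ofPath k p)) _ he)
      ((jacobiIdeal W).mul_mem_right _ (arrow k e) ih)
    rwa [← ofPath_mul_arrow, map_mul, ← sub_add_sub_cancel _ (T (ofPath k p) * arrow k e),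
      ← mul_sub, ← sub_mul]

end Substitution

/-- Eliminating arrows: if `φ` kills the cyclic derivatives of `W` along the arrows outside the
image of `ι`, and these express those arrows through the others, then the Jacobi algebra of `W`
is that of `φ(W)`. -/
theorem nonempty_jacobiAlgebra_algEquiv {V' : Type*} [Quiver V'] [Finite V]
    [∀ i j : V, Finite (i ⟶ j)] [Finite V'] [∀ i j : V', Finite (i ⟶ j)]
    (φ : Substitution k V V')
    (ι : ∀ {i j : V'}, (i ⟶ j) → (φ.vertex.symm i ⟶ φ.vertex.symm j))
    (hι : ∀ {i j : V'} (a : i ⟶ j), φ.image (ι a) = arrow k a)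
    {W : CompletePathAlgebra k V} {W' : CompletePathAlgebra k V'}
    (hW : CyclicallyEquivalent W' (φ.algHom W))
    (h : ∀ {i j : V} (a : i ⟶ j),
      (∃ (x y : V') (c : x ⟶ y), (⟨i, j, a⟩ : Σ i j : V, (i ⟶ j)) = ⟨_, _, ι c⟩) ∨
      (φ.algHom (cyclicDerivative a W) = 0 ∧
        (φ.embedding ι).algHom (φ.image a) - arrow k a ∈ jacobiIdeal W)) :
    Nonempty (JacobiAlgebra W ≃ₐ[k] JacobiAlgebra W') := by
  have := Fintype.ofFinite V
  have := fun i j : V => Fintype.ofFinite (i ⟶ j)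
  -- This is the chain rule with `1` in the gap. An arrow `ι c'` has image `c'` and contributes only
  -- if it is `ι c`; for any other arrow, `φ` kills the inserted cyclic derivative.
  have hc : ∀ {x y : V'} (c : x ⟶ y),
      φ.algHom (cyclicDerivative (ι c) W) = cyclicDerivative c W' := by
    intro x y c
    rw [hW.cyclicDerivative_eq, cyclicDerivative_eq c, ← map_one φ.algHom,
      φ.polarDerivative_algHom,
      Finset.sum_eq_single (⟨_, _, ι c⟩ : Σ i j : V, (i ⟶ j))]
    · simp only [hι, polarDerivative_arrow_self, ← cyclicDerivative_eq]
      conv_lhs => rw [← lazy_mul_cyclicDerivative_mul_lazy, map_mul φ.algHom, map_mul φ.algHom,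
        φ.algHom_lazy, φ.algHom_lazy, Equiv.apply_symm_apply, Equiv.apply_symm_apply]
    · rintro ⟨i, j, a⟩ _ ha
      rcases h a with ⟨x', y', c', h'⟩ | ⟨h', -⟩
      · rw [h'] at ha ⊢
        rw [hι, polarDerivative_arrow_of_ne]
        intro h''
        cases h''
        exact ha rfl
      · rw [← cyclicDerivative_eq, h', map_zero]
    · intro h
      exact absurd (Finset.mem_univ _) h
  have hsub := φ.algHom_embedding_algHom_sub_mem ι W fun a => by
    rcases h a with ⟨x, y, c, h'⟩ | ⟨-, h'⟩
    · cases h'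
      rw [hι, Substitution.algHom_arrow]
      change arrow k (ι c) - arrow k (ι c) ∈ _
      rw [sub_self]
      exact (jacobiIdeal W).zero_mem
    · exact h'
  refine ⟨TwoSidedIdeal.quotientEquiv _ _ φ.algHom (φ.embedding ι).algHom
    (fun f => map_mem_jacobiIdeal φ.adicContinuous_algHom fun a => ?_)
    (fun f => map_mem_jacobiIdeal (φ.embedding ι).adicContinuous_algHom fun c => ?_)
    hsub (fun f => ?_)⟩
  · rcases h a with ⟨x, y, c, h'⟩ | ⟨h', -⟩
    · cases h'
      rw [hc]
      exact cyclicDerivative_mem_jacobiIdeal W' c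
    · rw [h']
      exact (jacobiIdeal W').zero_mem
  -- The image of `∂_c W'` is that of `φ(∂_{ι c} W)`, which agrees with `∂_{ι c} W` modulo the
  -- ideal.
  · rw [← hc, ← sub_add_cancel ((φ.embedding ι).algHom _) (cyclicDerivative (ι c) W)]
    exact (jacobiIdeal W).add_mem (hsub _) (cyclicDerivative_mem_jacobiIdeal W _)
  · rw [φ.algHom_algHom_embedding ι hι, sub_self]
    exact (jacobiIdeal W').zero_mem

end CompletePathAlgebra

/-! ### Commutators and cyclic equivalence -/

namespace CompletePathAlgebra

open Quiver

variable {k : Type*} [CommRing k] {V : Type*} [Quiver V]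

/-- The span of the commutators. -/
def commutatorSpan (k V : Type*) [CommRing k] [Quiver V] :
    Submodule k (CompletePathAlgebra k V) :=
  Submodule.span k {c | ∃ p q : CompletePathAlgebra k V, c = p * q - q * p}

theorem commutator_mem (p q : CompletePathAlgebra k V) : p * q - q * p ∈ commutatorSpan k V :=
  Submodule.subset_span ⟨p, q, rfl⟩

theorem CyclicallyEquivalent.of_sub_mem {W W' W'' : CompletePathAlgebra k V}
    (h : CyclicallyEquivalent W W') (h' : W'' - W' ∈ commutatorSpan k V) :
    CyclicallyEquivalent W W'' := by
  intro N
  obtain ⟨g, hg, hN⟩ := h N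
  refine ⟨g - (W'' - W'), (commutatorSpan k V).sub_mem hg h', ?_⟩
  have := hN.sub (AgreeBelow.refl N (W'' - W'))
  rwa [sub_sub_sub_cancel_right] at this

end CompletePathAlgebra

namespace TypeA

open CompletePathAlgebra

variable {n : ℕ} {I : Finset ℕ}

instance : Finite (Vertex n I) := inferInstanceAs (Finite {v : ℕ // v ∈ Finset.Icc 1 n})

instance (v w : Vertex n I) : Finite (v ⟶ w) := by
  refine Finite.of_injective (β := Fin 3) (fun a : Arrow n I v w => match a with
    | .loop _ _ => 0
    | .right _ _ _ => 1
    | .left _ _ _ => 2) ?_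
  intro (a : Arrow n I v w) (b : Arrow n I v w) h
  cases a <;> cases b <;> first | rfl | (simp at h)

/-! ### Elements indexed by natural numbers -/

/-- The loop at `v`, or zero if there is none. -/
noncomputable def loopAt (n : ℕ) (I : Finset ℕ) (v : ℕ) : CompletePathAlgebra ℂ (Vertex n I) :=
  if h : v ∈ Finset.Icc 1 n ∧ v ∉ I then
    arrow ℂ (i := (⟨v, h.1⟩ : Vertex n I)) (j := ⟨v, h.1⟩) (Arrow.loop ⟨v, h.1⟩ h.2) else 0

/-- The arrow from `v` to `v + 1`, or zero if there is none. -/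
noncomputable def rightAt (n : ℕ) (I : Finset ℕ) (v : ℕ) : CompletePathAlgebra ℂ (Vertex n I) :=
  if h : v ∈ Finset.Icc 1 n ∧ v + 1 ∈ Finset.Icc 1 n then
    arrow ℂ (i := (⟨v, h.1⟩ : Vertex n I)) (j := ⟨v + 1, h.2⟩)
      (Arrow.right ⟨v, h.1⟩ ⟨v + 1, h.2⟩ rfl) else 0

/-- The arrow from `v + 1` to `v`, or zero if there is none. -/
noncomputable def leftAt (n : ℕ) (I : Finset ℕ) (v : ℕ) : CompletePathAlgebra ℂ (Vertex n I) :=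
  if h : v ∈ Finset.Icc 1 n ∧ v + 1 ∈ Finset.Icc 1 n then
    arrow ℂ (i := (⟨v + 1, h.2⟩ : Vertex n I)) (j := ⟨v, h.1⟩)
      (Arrow.left ⟨v, h.1⟩ ⟨v + 1, h.2⟩ rfl) else 0

/-- The cycle `v → v + 1 → v`, or zero. -/
noncomputable def outAt (n : ℕ) (I : Finset ℕ) (v : ℕ) : CompletePathAlgebra ℂ (Vertex n I) :=
  rightAt n I v * leftAt n I v

/-- The cycle `v + 1 → v → v + 1`, or zero. -/
noncomputable def backAt (n : ℕ) (I : Finset ℕ) (v : ℕ) : CompletePathAlgebra ℂ (Vertex n I) :=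
  leftAt n I v * rightAt n I v

theorem loopAt_coe (v : Vertex n I) (hv : v.1 ∉ I) :
    loopAt n I v.1 = arrow ℂ (i := v) (j := v) (Arrow.loop v hv) := dif_pos ⟨v.2, hv⟩

theorem loopAt_of_notMem {v : ℕ} (h : ¬(v ∈ Finset.Icc 1 n ∧ v ∉ I)) : loopAt n I v = 0 :=
  dif_neg h

theorem rightAt_coe (v w : Vertex n I) (h : v.1 + 1 = w.1) :
    rightAt n I v.1 = arrow ℂ (i := v) (j := w) (Arrow.right v w h) := by
  obtain ⟨w, hw⟩ := w
  obtain rfl : v.1 + 1 = w := h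
  exact dif_pos ⟨v.2, hw⟩

theorem leftAt_coe (v w : Vertex n I) (h : v.1 + 1 = w.1) :
    leftAt n I v.1 = arrow ℂ (i := w) (j := v) (Arrow.left v w h) := by
  obtain ⟨w, hw⟩ := w
  obtain rfl : v.1 + 1 = w := h
  exact dif_pos ⟨v.2, hw⟩

theorem rightAt_of_notMem {v : ℕ} (h : ¬(v ∈ Finset.Icc 1 n ∧ v + 1 ∈ Finset.Icc 1 n)) :
    rightAt n I v = 0 := dif_neg h

theorem leftAt_of_notMem {v : ℕ} (h : ¬(v ∈ Finset.Icc 1 n ∧ v + 1 ∈ Finset.Icc 1 n)) :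
    leftAt n I v = 0 := dif_neg h

theorem outAt_of_notMem {v : ℕ} (h : ¬(v ∈ Finset.Icc 1 n ∧ v + 1 ∈ Finset.Icc 1 n)) :
    outAt n I v = 0 := by rw [outAt, rightAt_of_notMem h, zero_mul]

theorem backAt_of_notMem {v : ℕ} (h : ¬(v ∈ Finset.Icc 1 n ∧ v + 1 ∈ Finset.Icc 1 n)) :
    backAt n I v = 0 := by rw [backAt, leftAt_of_notMem h, zero_mul]

theorem loopAt_agreeBelow (v : ℕ) : AgreeBelow 1 (loopAt n I v) 0 := by
  unfold loopAt
  split_ifs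
  · exact arrow_agreeBelow _
  · exact AgreeBelow.refl _ _

theorem rightAt_agreeBelow (v : ℕ) : AgreeBelow 1 (rightAt n I v) 0 := by
  unfold rightAt
  split_ifs
  · exact arrow_agreeBelow _
  · exact AgreeBelow.refl _ _

theorem leftAt_agreeBelow (v : ℕ) : AgreeBelow 1 (leftAt n I v) 0 := by
  unfold leftAt
  split_ifs
  · exact arrow_agreeBelow _
  · exact AgreeBelow.refl _ _

theorem outAt_agreeBelow (v : ℕ) : AgreeBelow 1 (outAt n I v) 0 :=
  (mul_agreeBelow_zero (rightAt_agreeBelow v) (leftAt_agreeBelow v)).mono (by omega)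

theorem backAt_agreeBelow (v : ℕ) : AgreeBelow 1 (backAt n I v) 0 :=
  (mul_agreeBelow_zero (leftAt_agreeBelow v) (rightAt_agreeBelow v)).mono (by omega)

theorem lazy_mul_rightAt (v : Vertex n I) : lazy ℂ v * rightAt n I v.1 = rightAt n I v.1 := by
  unfold rightAt
  split_ifs with h
  · exact lazy_mul_ofPath _
  · exact mul_zero _

theorem leftAt_mul_lazy (v : Vertex n I) : leftAt n I v.1 * lazy ℂ v = leftAt n I v.1 := by
  unfold leftAt
  split_ifs with h
  · exact ofPath_mul_lazy _
  · exact zero_mul _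

theorem rightAt_mul_lazy (v w : Vertex n I) (h : v.1 + 1 = w.1) :
    rightAt n I v.1 * lazy ℂ w = rightAt n I v.1 := by
  rw [rightAt_coe v w h]
  exact ofPath_mul_lazy _

theorem lazy_mul_leftAt (v w : Vertex n I) (h : v.1 + 1 = w.1) :
    lazy ℂ w * leftAt n I v.1 = leftAt n I v.1 := by
  rw [leftAt_coe v w h]
  exact lazy_mul_ofPath _

theorem lazy_mul_outAt (v : Vertex n I) : lazy ℂ v * outAt n I v.1 = outAt n I v.1 := by
  rw [outAt, ← mul_assoc, lazy_mul_rightAt]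

theorem outAt_mul_lazy (v : Vertex n I) : outAt n I v.1 * lazy ℂ v = outAt n I v.1 := by
  rw [outAt, mul_assoc, leftAt_mul_lazy]

theorem lazy_mul_backAt (v : Vertex n I) :
    lazy ℂ v * backAt n I (v.1 - 1) = backAt n I (v.1 - 1) := by
  by_cases h : v.1 - 1 ∈ Finset.Icc 1 n
  · have := Finset.mem_Icc.1 h
    rw [backAt, ← mul_assoc, lazy_mul_leftAt ⟨v.1 - 1, h⟩ v (by simp; omega)]
  -- This is the case `v = 1`, where `v - 1 = 0` is not a vertex and `backAt` takes its default
  -- value zero.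
  · rw [backAt_of_notMem fun h' => h h'.1, mul_zero]

theorem backAt_mul_lazy (v : Vertex n I) :
    backAt n I (v.1 - 1) * lazy ℂ v = backAt n I (v.1 - 1) := by
  by_cases h : v.1 - 1 ∈ Finset.Icc 1 n
  · have := Finset.mem_Icc.1 h
    rw [backAt, mul_assoc, rightAt_mul_lazy ⟨v.1 - 1, h⟩ v (by simp; omega)]
  · rw [backAt_of_notMem fun h' => h h'.1, zero_mul]

theorem lazy_mul_loopAt (v : Vertex n I) : lazy ℂ v * loopAt n I v.1 = loopAt n I v.1 := by
  unfold loopAt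
  split_ifs with h
  · exact lazy_mul_ofPath _
  · exact mul_zero _

theorem loopAt_mul_lazy (v : Vertex n I) : loopAt n I v.1 * lazy ℂ v = loopAt n I v.1 := by
  unfold loopAt
  split_ifs with h
  · exact ofPath_mul_lazy _
  · exact zero_mul _

theorem Slot.loop_x (v : Vertex n I) (hv : v.1 ∉ I) : (Slot.loop v hv).x = loopAt n I v.1 := by
  rw [loopAt_coe v hv]
  exact ofPath_mul_lazy _

theorem Slot.loop_x' (v : Vertex n I) (hv : v.1 ∉ I) : (Slot.loop v hv).x' = loopAt n I v.1 := by
  rw [loopAt_coe v hv]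
  exact lazy_mul_ofPath _

theorem Slot.edge_x (v w : Vertex n I) (h : v.1 + 1 = w.1) :
    (Slot.edge v w h).x = outAt n I v.1 := by
  rw [outAt, rightAt_coe v w h, leftAt_coe v w h]
  rfl

theorem Slot.edge_x' (v w : Vertex n I) (h : v.1 + 1 = w.1) :
    (Slot.edge v w h).x' = backAt n I v.1 := by
  rw [backAt, rightAt_coe v w h, leftAt_coe v w h]
  rfl

/-! ### The numbering of the slots -/

/-- The number of slots up to a given position. -/
noncomputable def labelAt (n : ℕ) (I : Finset ℕ) (p : ℕ) : ℕ :=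
  (Finset.univ.filter fun t : Slot n I => t.position ≤ p).card

/-- A label counts the slots up to a position, so consecutive labels mean that no slot lies strictly
between. This turns questions about the numbering into inequalities between positions. -/
theorem Slot.label_eq_label_add_one_iff (s t : Slot n I) :
    t.label = s.label + 1 ↔
      s.position < t.position ∧ ∀ r : Slot n I, r.position ≤ s.position ∨ t.position ≤ r.position := by
  classical
  rcases le_or_gt t.position s.position with h | h
  · have : t.label ≤ s.label := Finset.card_le_card fun r hr => by
      simp only [Finset.mem_filter, Finset.mem_univ, true_and] at hr ⊢
      omega
    constructor <;> intro <;> omega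
  · have hsub : insert t (Finset.univ.filter fun r : Slot n I => r.position ≤ s.position) ⊆
        Finset.univ.filter fun r : Slot n I => r.position ≤ t.position := by
      intro r hr
      simp only [Finset.mem_insert, Finset.mem_filter, Finset.mem_univ, true_and] at hr ⊢
      rcases hr with rfl | hr <;> omega
    have hcard : (insert t (Finset.univ.filter
        fun r : Slot n I => r.position ≤ s.position)).card = s.label + 1 := by
      rw [Finset.card_insert_of_notMem (by simpa using h)]
      rfl
    constructor
    · intro hl
      have heq := Finset.eq_of_subset_of_card_le hsub (by rw [hcard, ← hl]; rfl)
      refine ⟨h, fun r => ?_⟩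
      by_contra! hr
      have : r ∈ Finset.univ.filter fun r : Slot n I => r.position ≤ t.position := by
        simpa using hr.2.le
      rw [← heq] at this
      simp only [Finset.mem_insert, Finset.mem_filter, Finset.mem_univ, true_and] at this
      rcases this with rfl | hr' <;> omega
    · rintro ⟨-, hr⟩
      rw [← hcard]
      refine congrArg _ (Finset.Subset.antisymm (fun r hrt => ?_) hsub)
      simp only [Finset.mem_insert, Finset.mem_filter, Finset.mem_univ, true_and] at hrt ⊢
      rcases hr r with h' | h'
      · exact Or.inr h'
      · exact Or.inl (Slot.position_injective (le_antisymm hrt h'))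

/-- With all loops present, the positions fill `1, …, 2n - 1` without gaps. The bound on `p` is
needed because the count stops growing after the last slot. -/
theorem labelAt_empty {p : ℕ} (hp : p ≤ 2 * n - 1) : labelAt n ∅ p = p := by
  classical
  have : (Finset.univ.filter fun t : Slot n ∅ => t.position ≤ p).image Slot.position =
      Finset.Icc 1 p := by
    ext q
    simp only [Finset.mem_image, Finset.mem_filter, Finset.mem_univ, true_and, Finset.mem_Icc]
    constructor
    · rintro ⟨t, ht, rfl⟩
      refine ⟨?_, ht⟩
      cases t with
      | loop v hv => have := Finset.mem_Icc.1 v.2; simp only [Slot.position]; omega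
      | edge v w h => have := Finset.mem_Icc.1 v.2; simp only [Slot.position]; omega
    · rintro ⟨h₁, h₂⟩
      rcases Nat.even_or_odd' q with ⟨m, rfl | rfl⟩
      · exact ⟨.edge ⟨m, by simp; omega⟩ ⟨m + 1, by simp; omega⟩ rfl, h₂, rfl⟩
      · refine ⟨.loop ⟨m + 1, by simp; omega⟩ (by simp), ?_, ?_⟩ <;>
          simp only [Slot.position] <;> omega
  rw [labelAt, ← Finset.card_image_of_injective _ Slot.position_injective, this, Nat.card_Icc,
    Nat.add_sub_cancel]

/-- A sum over the slots as a sum over the vertices. -/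
theorem sum_slot {M : Type*} [AddCommMonoid M] (F : Slot n I → M) (L E : ℕ → M)
    (hL : ∀ v hv, F (.loop v hv) = L v.1) (hE : ∀ v w h, F (.edge v w h) = E v.1)
    (hL' : ∀ v ∈ I, L v = 0) (hE' : E n = 0) :
    ∑ s, F s = ∑ v ∈ Finset.Icc 1 n, (L v + E v) := by
  classical
  -- Even positions are edges and odd ones loops. The positions in `1, …, 2n` without a slot, namely
  -- `2n` and those of deleted loops, contribute zero by `hE'` and `hL'`.
  let G : ℕ → M := fun p => if p % 2 = 0 then E (p / 2) else L ((p + 1) / 2)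
  have hG : ∀ s, F s = G s.position := by
    rintro (⟨v, hv⟩ | ⟨v, w, h⟩)
    · have := Finset.mem_Icc.1 v.2
      simp only [G, Slot.position]
      rw [hL, if_neg (by omega)]
      congr 1
      omega
    · simp only [G, Slot.position]
      rw [hE, if_pos (by omega)]
      congr 1
      omega
  have h₁ : ∀ m : ℕ, ∑ p ∈ Finset.Icc 1 (2 * m), G p = ∑ v ∈ Finset.Icc 1 m, (L v + E v) := by
    intro m
    induction m with
    | zero => simp
    | succ m ih =>
      rw [Finset.sum_Icc_succ_top (by omega), ← ih, show 2 * (m + 1) = 2 * m + 1 + 1 by ring,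
        Finset.sum_Icc_succ_top (by omega), Finset.sum_Icc_succ_top (by omega), add_assoc]
      congr 2
      · simp only [G]
        rw [if_neg (by omega)]
        congr 1
        omega
      · simp only [G]
        rw [if_pos (by omega)]
        congr 1
        omega
  rw [← h₁, Finset.sum_congr rfl fun s _ => hG s,
    ← Finset.sum_image (f := G) (g := Slot.position) fun s _ t _ h => Slot.position_injective h]
  refine Finset.sum_subset ?_ fun p hp hp' => ?_
  · intro p hp
    obtain ⟨s, -, rfl⟩ := Finset.mem_image.1 hp
    rw [Finset.mem_Icc]
    cases s with
    | loop v hv => have := Finset.mem_Icc.1 v.2; simp only [Slot.position]; omega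
    | edge v w h => have := Finset.mem_Icc.1 v.2; simp only [Slot.position]; omega
  · rw [Finset.mem_Icc] at hp
    simp only [Finset.mem_image, Finset.mem_univ, true_and, not_exists] at hp'
    rcases Nat.even_or_odd' p with ⟨m, rfl | rfl⟩
    · rcases (show m ≤ n by omega).eq_or_lt with rfl | hm
      · simp only [G]
        rw [if_pos (by omega), Nat.mul_div_cancel_left _ (by omega), hE']
      · exact absurd rfl (hp' (.edge ⟨m, by simp; omega⟩ ⟨m + 1, by simp; omega⟩ rfl))
    · simp only [G]
      rw [if_neg (by omega), show (2 * m + 1 + 1) / 2 = m + 1 by omega]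
      refine hL' _ ?_
      by_contra hm
      refine hp' (.loop ⟨m + 1, by simp; omega⟩ hm) ?_
      simp only [Slot.position]
      omega

/-- The slot after a loop is the edge to its right. At the last vertex there is none, and `outAt` is
zero. -/
theorem sum_next_loop (v : Vertex n I) (hv : v.1 ∉ I) :
    ∑ t : Slot n I with t.label = (Slot.loop v hv).label + 1, t.x = outAt n I v.1 := by
  have hv' := Finset.mem_Icc.1 v.2
  rw [Finset.sum_filter, sum_slot _ 0 (fun u => if u = v.1 then outAt n I u else 0)]
  · simp
    intro h
    omega
  · intro u hu
    have hu' := Finset.mem_Icc.1 u.2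
    rw [if_neg]
    · rfl
    · rw [Slot.label_eq_label_add_one_iff]
      rintro ⟨h₁, h₂⟩
      simp only [Slot.position] at h₁
      have := h₂ (.edge v ⟨v.1 + 1, by simp; omega⟩ rfl)
      simp only [Slot.position] at this
      omega
  · intro u w h
    have hu' := Finset.mem_Icc.1 u.2
    have hw' := Finset.mem_Icc.1 w.2
    rw [Slot.edge_x]
    refine if_congr ?_ rfl rfl
    rw [Slot.label_eq_label_add_one_iff]
    constructor
    · rintro ⟨h₁, h₂⟩
      simp only [Slot.position] at h₁
      have := h₂ (.edge v ⟨v.1 + 1, by simp; omega⟩ rfl)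
      simp only [Slot.position] at this
      omega
    · intro huv
      refine ⟨by simp only [Slot.position]; omega, fun r => ?_⟩
      cases r <;> simp only [Slot.position] <;> omega
  · intro _ _; rfl
  · rw [outAt_of_notMem (by simp), ite_self]

/-- The slot after an edge is the loop at its right end or, if that loop is deleted, the next edge.
Since `loopAt` vanishes on `I`, one formula covers both cases. -/
theorem sum_next_edge (v w : Vertex n I) (h : v.1 + 1 = w.1) :
    ∑ t : Slot n I with t.label = (Slot.edge v w h).label + 1, t.x =
      loopAt n I (v.1 + 1) + if v.1 + 1 ∈ I then outAt n I (v.1 + 1) else 0 := by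
  have hv' := Finset.mem_Icc.1 v.2
  have hw' := Finset.mem_Icc.1 w.2
  rw [Finset.sum_filter, sum_slot _ (fun u => if u = v.1 + 1 then loopAt n I u else 0)
    (fun u => if u = v.1 + 1 then (if u ∈ I then outAt n I u else 0) else 0)]
  · rw [Finset.sum_add_distrib, Finset.sum_ite_eq', Finset.sum_ite_eq',
      if_pos (by simp; omega), if_pos (by simp; omega)]
  · intro u hu
    have hu' := Finset.mem_Icc.1 u.2
    rw [Slot.loop_x]
    refine if_congr ?_ rfl rfl
    rw [Slot.label_eq_label_add_one_iff]
    constructor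
    · rintro ⟨h₁, h₂⟩
      simp only [Slot.position] at h₁
      by_contra huv
      have := h₂ (.edge w ⟨w.1 + 1, by simp; omega⟩ rfl)
      simp only [Slot.position] at this
      omega
    · intro huv
      refine ⟨by simp only [Slot.position]; omega, fun r => ?_⟩
      cases r <;> simp only [Slot.position] <;> omega
  · intro u z h'
    have hu' := Finset.mem_Icc.1 u.2
    have hz' := Finset.mem_Icc.1 z.2
    rw [Slot.edge_x, ← ite_and]
    refine if_congr ?_ rfl rfl
    rw [Slot.label_eq_label_add_one_iff]
    constructor
    · rintro ⟨h₁, h₂⟩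
      simp only [Slot.position] at h₁
      have h₃ := h₂ (.edge w ⟨w.1 + 1, by simp; omega⟩ rfl)
      simp only [Slot.position] at h₃
      have huw : u = w := Subtype.ext (by omega)
      subst huw
      refine ⟨h.symm, ?_⟩
      by_contra hu
      have h₄ := h₂ (.loop u hu)
      simp only [Slot.position] at h₄
      omega
    · rintro ⟨huv, hu⟩
      refine ⟨by simp only [Slot.position]; omega, fun r => ?_⟩
      cases r with
      | loop r hr =>
        have : r.1 ≠ u.1 := fun h => hr (h ▸ hu)
        simp only [Slot.position]
        omega
      | edge r _ _ => simp only [Slot.position]; omega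
  · intro u hu
    rw [loopAt_of_notMem fun h => h.2 hu, ite_self]
  · rw [outAt_of_notMem (by simp), ite_self, ite_self]

theorem monomialPotential_eq (κ : ℕ → ℕ → ℂ) :
    monomialPotential n I κ = ∑ v ∈ Finset.Icc 1 n,
      (loopAt n I v * outAt n I v +
        backAt n I v * (loopAt n I (v + 1) + if v + 1 ∈ I then outAt n I (v + 1) else 0) +
        seriesFromTwo (κ (labelAt n I (2 * v - 1))) (loopAt n I v) +
        seriesFromTwo (κ (labelAt n I (2 * v))) (outAt n I v)) := by
  rw [monomialPotential]
  simp only [← Finset.mul_sum]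
  rw [sum_slot (fun s : Slot n I =>
      s.x' * ∑ t : Slot n I with t.label = s.label + 1, t.x)
      (fun v => loopAt n I v * outAt n I v) (fun v => backAt n I v * (loopAt n I (v + 1) +
        if v + 1 ∈ I then outAt n I (v + 1) else 0)),
    sum_slot (fun s : Slot n I => seriesFromTwo (κ s.label) s.x)
      (fun v => seriesFromTwo (κ (labelAt n I (2 * v - 1))) (loopAt n I v))
      (fun v => seriesFromTwo (κ (labelAt n I (2 * v))) (outAt n I v)),
    ← Finset.sum_add_distrib]
  · simp only [add_assoc]
  · intro v hv
    rw [Slot.loop_x]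
    rfl
  · intro v w h
    rw [Slot.edge_x]
    rfl
  · intro v hv
    rw [loopAt_of_notMem fun h => h.2 hv, seriesFromTwo_zero]
  · rw [outAt_of_notMem (by simp), seriesFromTwo_zero]
  · intro v hv
    rw [sum_next_loop, Slot.loop_x']
  · intro v w h
    rw [sum_next_edge, Slot.edge_x']
  · intro v hv
    rw [loopAt_of_notMem fun h => h.2 hv, zero_mul]
  · rw [backAt_of_notMem (by simp), zero_mul]

theorem monomialPotential_empty (κ : ℕ → ℕ → ℂ) :
    monomialPotential n ∅ κ = ∑ v ∈ Finset.Icc 1 n,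
      (loopAt n ∅ v * outAt n ∅ v + backAt n ∅ v * loopAt n ∅ (v + 1) +
        seriesFromTwo (κ (2 * v - 1)) (loopAt n ∅ v) +
        seriesFromTwo (κ (2 * v)) (outAt n ∅ v)) := by
  rw [monomialPotential_eq]
  refine Finset.sum_congr rfl fun v hv => ?_
  rw [Finset.mem_Icc] at hv
  rw [if_neg (by simp), add_zero, labelAt_empty (by omega)]
  congr 1
  -- For `v = n` the position `2n` is past the last slot and the two coefficient sequences may
  -- differ, but `outAt` is zero there.
  rcases hv.2.eq_or_lt with rfl | h
  · rw [outAt_of_notMem (by simp), seriesFromTwo_zero, seriesFromTwo_zero]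
  · rw [labelAt_empty (by omega)]

end TypeA

namespace TypeA

open CompletePathAlgebra

variable {n : ℕ} {I : Finset ℕ}

/-! ### Eliminating the loops at the vertices in `I` -/

/-- The vertices do not depend on the set of deleted loops. -/
def vertexEquiv (n : ℕ) (I J : Finset ℕ) : Vertex n I ≃ Vertex n J where
  toFun v := ⟨v.1, v.2⟩
  invFun v := ⟨v.1, v.2⟩
  left_inv _ := rfl
  right_inv _ := rfl

/-- What is put in place of the loop at `v`. -/
noncomputable def loopImage (n : ℕ) (I : Finset ℕ) (v : ℕ) : CompletePathAlgebra ℂ (Vertex n I) :=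
  -- For `v` in `I` this is the solution of the Jacobi relation for the loop.
  if v ∈ I then backAt n I (v - 1) + outAt n I v else loopAt n I v

/-- The images of the arrows of `Q_n` in the complete path algebra of `Q_{n,I}`. -/
noncomputable def arrowImage : ∀ {v w : Vertex n ∅}, Arrow n ∅ v w →
    CompletePathAlgebra ℂ (Vertex n I)
  | _, _, .loop v _ => loopImage n I v.1
  | _, _, .right v _ _ => rightAt n I v.1
  | _, _, .left v _ _ => leftAt n I v.1

theorem loopImage_agreeBelow (v : ℕ) : AgreeBelow 1 (loopImage n I v) 0 := by
  unfold loopImage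
  split_ifs
  · simpa using (backAt_agreeBelow (n := n) (I := I) (v - 1)).add (outAt_agreeBelow v)
  · exact loopAt_agreeBelow v

theorem lazy_mul_loopImage (v : Vertex n I) :
    lazy ℂ v * loopImage n I v.1 = loopImage n I v.1 := by
  unfold loopImage
  split_ifs
  · rw [mul_add, lazy_mul_backAt, lazy_mul_outAt]
  · exact lazy_mul_loopAt v

theorem loopImage_mul_lazy (v : Vertex n I) :
    loopImage n I v.1 * lazy ℂ v = loopImage n I v.1 := by
  unfold loopImage
  split_ifs
  · rw [add_mul, backAt_mul_lazy, outAt_mul_lazy]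
  · exact loopAt_mul_lazy v

/-- The substitution which eliminates the loops at the vertices in `I`. -/
noncomputable def elimination (n : ℕ) (I : Finset ℕ) :
    Substitution ℂ (Vertex n ∅) (Vertex n I) where
  vertex := vertexEquiv n ∅ I
  image a := arrowImage a
  lazy_mul_image := by
    rintro v w (⟨_, hv⟩ | ⟨_, _, h⟩ | ⟨_, _, h⟩)
    · exact lazy_mul_loopImage (vertexEquiv n ∅ I v)
    · exact lazy_mul_rightAt (vertexEquiv n ∅ I v)
    · exact lazy_mul_leftAt (vertexEquiv n ∅ I w) (vertexEquiv n ∅ I v) h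
  image_mul_lazy := by
    rintro v w (⟨_, hv⟩ | ⟨_, _, h⟩ | ⟨_, _, h⟩)
    · exact loopImage_mul_lazy (vertexEquiv n ∅ I v)
    · exact rightAt_mul_lazy (vertexEquiv n ∅ I v) (vertexEquiv n ∅ I w) h
    · exact leftAt_mul_lazy (vertexEquiv n ∅ I w)
  image_agreeBelow := by
    rintro v w (⟨_, hv⟩ | ⟨_, _, h⟩ | ⟨_, _, h⟩)
    · exact loopImage_agreeBelow _
    · exact rightAt_agreeBelow _
    · exact leftAt_agreeBelow _

/-- The arrows of `Q_{n,I}` as arrows of `Q_n`. -/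
def arrowInclusion : ∀ {v w : Vertex n I}, (v ⟶ w) →
    ((elimination n I).vertex.symm v ⟶ (elimination n I).vertex.symm w)
  | _, _, .loop v _ => Arrow.loop (vertexEquiv n I ∅ v) (Finset.notMem_empty _)
  | _, _, .right v w h => Arrow.right (vertexEquiv n I ∅ v) (vertexEquiv n I ∅ w) h
  | _, _, .left v w h => Arrow.left (vertexEquiv n I ∅ v) (vertexEquiv n I ∅ w) h

theorem algHom_loopAt (hI : I ⊆ Finset.Icc 1 n) (v : ℕ) :
    (elimination n I).algHom (loopAt n ∅ v) = loopImage n I v := by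
  by_cases h : v ∈ Finset.Icc 1 n
  · obtain ⟨v, rfl⟩ : ∃ v' : Vertex n ∅, v'.1 = v := ⟨⟨v, h⟩, rfl⟩
    rw [loopAt_coe v (Finset.notMem_empty _), Substitution.algHom_arrow]
    rfl
  · rw [loopAt_of_notMem fun h' => h h'.1, map_zero, loopImage, if_neg fun h' => h (hI h'),
      loopAt_of_notMem fun h' => h h'.1]

theorem algHom_rightAt (v : ℕ) :
    (elimination n I).algHom (rightAt n ∅ v) = rightAt n I v := by
  by_cases h : v ∈ Finset.Icc 1 n ∧ v + 1 ∈ Finset.Icc 1 n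
  · obtain ⟨v, rfl⟩ : ∃ v' : Vertex n ∅, v'.1 = v := ⟨⟨v, h.1⟩, rfl⟩
    obtain ⟨w, hw⟩ : ∃ w : Vertex n ∅, v.1 + 1 = w.1 := ⟨⟨v.1 + 1, h.2⟩, rfl⟩
    rw [rightAt_coe v w hw, Substitution.algHom_arrow]
    rfl
  · rw [rightAt_of_notMem h, rightAt_of_notMem h, map_zero]

theorem algHom_leftAt (v : ℕ) :
    (elimination n I).algHom (leftAt n ∅ v) = leftAt n I v := by
  by_cases h : v ∈ Finset.Icc 1 n ∧ v + 1 ∈ Finset.Icc 1 n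
  · obtain ⟨v, rfl⟩ : ∃ v' : Vertex n ∅, v'.1 = v := ⟨⟨v, h.1⟩, rfl⟩
    obtain ⟨w, hw⟩ : ∃ w : Vertex n ∅, v.1 + 1 = w.1 := ⟨⟨v.1 + 1, h.2⟩, rfl⟩
    rw [leftAt_coe v w hw, Substitution.algHom_arrow]
    rfl
  · rw [leftAt_of_notMem h, leftAt_of_notMem h, map_zero]

theorem algHom_outAt (v : ℕ) : (elimination n I).algHom (outAt n ∅ v) = outAt n I v := by
  rw [outAt, map_mul, algHom_rightAt, algHom_leftAt, outAt]

theorem algHom_backAt (v : ℕ) : (elimination n I).algHom (backAt n ∅ v) = backAt n I v := by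
  rw [backAt, map_mul, algHom_rightAt, algHom_leftAt, backAt]

/-- The indicator function of `I`. -/
noncomputable def indicator (I : Finset ℕ) (v : ℕ) : ℂ := if v ∈ I then 1 else 0

/-- The coefficients for `Q_n` obtained from those for `Q_{n,I}`. -/
noncomputable def liftedCoeff (n : ℕ) (I : Finset ℕ) (κ : ℕ → ℕ → ℂ) (p : ℕ) : ℕ → ℂ :=
  -- On an edge, each endpoint in `I` costs `1/2`, cancelling the square left by its eliminated
  -- loop. On a loop at a vertex of `I`, the value `-1/2` makes the Jacobi relation read `a = b +
  -- o`.
  if p % 2 = 0 then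
    κ (labelAt n I p) + quadratic (-(1 / 2) * (indicator I (p / 2) + indicator I (p / 2 + 1)))
  else if (p + 1) / 2 ∈ I then quadratic (-(1 / 2)) else κ (labelAt n I p)

theorem liftedCoeff_edge (κ : ℕ → ℕ → ℂ) (v : ℕ) :
    liftedCoeff n I κ (2 * v) =
      κ (labelAt n I (2 * v)) + quadratic (-(1 / 2) * (indicator I v + indicator I (v + 1))) := by
  rw [liftedCoeff, if_pos (by omega), Nat.mul_div_cancel_left _ (by omega)]

theorem liftedCoeff_loop (κ : ℕ → ℕ → ℂ) {v : ℕ} (hv : 1 ≤ v) :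
    liftedCoeff n I κ (2 * v - 1) =
      if v ∈ I then quadratic (-(1 / 2)) else κ (labelAt n I (2 * v - 1)) := by
  rw [liftedCoeff, if_neg (by omega), show (2 * v - 1 + 1) / 2 = v by omega]

/-! ### Completing the square in the lifted potential -/

theorem algHom_monomialPotential (hI : I ⊆ Finset.Icc 1 n) (κ : ℕ → ℕ → ℂ) :
    (elimination n I).algHom (monomialPotential n ∅ κ) = ∑ v ∈ Finset.Icc 1 n,
      (loopImage n I v * outAt n I v + backAt n I v * loopImage n I (v + 1) +
        seriesFromTwo (κ (2 * v - 1)) (loopImage n I v) +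
        seriesFromTwo (κ (2 * v)) (outAt n I v)) := by
  rw [monomialPotential_empty, map_sum]
  refine Finset.sum_congr rfl fun v _ => ?_
  rw [map_add, map_add, map_add, map_mul, map_mul, algHom_outAt, algHom_backAt,
    algHom_loopAt hI, algHom_loopAt hI, Substitution.algHom_seriesFromTwo _ _ (loopAt_agreeBelow v),
    Substitution.algHom_seriesFromTwo _ _ (outAt_agreeBelow v), algHom_loopAt hI, algHom_outAt]

theorem algHom_lifted_sub_mem (hI : I ⊆ Finset.Icc 1 n) (κ : ℕ → ℕ → ℂ) :
    (elimination n I).algHom (monomialPotential n ∅ (liftedCoeff n I κ)) -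
      monomialPotential n I κ ∈ commutatorSpan ℂ (Vertex n I) := by
  -- For `v` in `I`, the square of `backAt (v - 1)` arises in the summands of both `v - 1` and `v`.
  -- Beyond the commutator combinations `R`, these leave `(1/2) h v` and `-(1/2) h v`, so the sum
  -- telescopes.
  let h : ℕ → CompletePathAlgebra ℂ (Vertex n I) := fun v => indicator I v • backAt n I (v - 1) ^ 2
  let R : ℕ → CompletePathAlgebra ℂ (Vertex n I) := fun v =>
    (1 / 2 : ℂ) • (indicator I v • (backAt n I (v - 1) * outAt n I v -
      outAt n I v * backAt n I (v - 1))) +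
    (1 / 2 : ℂ) • (indicator I (v + 1) • (backAt n I v ^ 2 - outAt n I v ^ 2))
  have hloop : ∀ v ∈ Finset.Icc 1 n, seriesFromTwo (liftedCoeff n I κ (2 * v - 1)) (loopImage n I v) =
      seriesFromTwo (κ (labelAt n I (2 * v - 1))) (loopAt n I v) -
        (1 / 2 : ℂ) • indicator I v • (backAt n I (v - 1) + outAt n I v) ^ 2 := by
    intro v hv
    rw [liftedCoeff_loop κ (Finset.mem_Icc.1 hv).1]
    by_cases hvI : v ∈ I
    · rw [if_pos hvI, seriesFromTwo_quadratic _ (loopImage_agreeBelow v),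
        loopAt_of_notMem fun h => h.2 hvI, seriesFromTwo_zero, loopImage, if_pos hvI, indicator,
        if_pos hvI]
      module
    · rw [if_neg hvI, loopImage, if_neg hvI, indicator, if_neg hvI]
      module
  have hterm : ∀ v ∈ Finset.Icc 1 n,
      (loopImage n I v * outAt n I v + backAt n I v * loopImage n I (v + 1) +
        seriesFromTwo (liftedCoeff n I κ (2 * v - 1)) (loopImage n I v) +
        seriesFromTwo (liftedCoeff n I κ (2 * v)) (outAt n I v)) -
      (loopAt n I v * outAt n I v +
        backAt n I v * (loopAt n I (v + 1) + if v + 1 ∈ I then outAt n I (v + 1) else 0) +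
        seriesFromTwo (κ (labelAt n I (2 * v - 1))) (loopAt n I v) +
        seriesFromTwo (κ (labelAt n I (2 * v))) (outAt n I v)) =
      R v + (1 / 2 : ℂ) • (h (v + 1) - h v) := by
    intro v hv
    -- Writing both cases through `indicator` makes the identity of summands a linear one, with no
    -- case distinction left.
    have h₁ : loopImage n I v = loopAt n I v +
        indicator I v • (backAt n I (v - 1) + outAt n I v) := by
      unfold loopImage indicator
      split_ifs with hvI
      · rw [loopAt_of_notMem fun h => h.2 hvI, zero_add, one_smul]
      · rw [zero_smul, add_zero]
    have h₂ : loopImage n I (v + 1) = loopAt n I (v + 1) +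
        (if v + 1 ∈ I then outAt n I (v + 1) else 0) + indicator I (v + 1) • backAt n I v := by
      unfold loopImage indicator
      split_ifs with hvI
      · rw [loopAt_of_notMem fun h => h.2 hvI, zero_add, one_smul, add_comm, Nat.add_sub_cancel]
      · rw [zero_smul, add_zero, add_zero]
    rw [hloop v hv, h₁, h₂, liftedCoeff_edge, seriesFromTwo_add,
      seriesFromTwo_quadratic _ (outAt_agreeBelow v)]
    simp only [R, h, Nat.add_sub_cancel, pow_two, add_mul, mul_add, smul_mul_assoc,
      mul_smul_comm]
    module
  rw [algHom_monomialPotential hI, monomialPotential_eq, ← Finset.sum_sub_distrib,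
    Finset.sum_congr rfl hterm, Finset.sum_add_distrib, ← Finset.smul_sum,
    ← Finset.Ico_add_one_right_eq_Icc, Finset.sum_Ico_sub h (by omega)]
  -- Both ends of the telescoping sum vanish: `n + 1` is not in `I`, and `backAt` is zero at `0`.
  have hn : h (n + 1) = 0 := by
    have : n + 1 ∉ I := fun h => by simpa using hI h
    simp [h, indicator, this]
  have h1 : h 1 = 0 := by
    simp [h, backAt_of_notMem]
  rw [hn, h1, sub_zero, smul_zero, add_zero]
  refine Submodule.sum_mem _ fun v _ => Submodule.add_mem _ ?_ ?_
  · exact Submodule.smul_mem _ _ (Submodule.smul_mem _ _ (commutator_mem _ _))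
  · refine Submodule.smul_mem _ _ (Submodule.smul_mem _ _ ?_)
    -- With `l`, `r` the arrows of the edge, `(l r) ^ 2 - (r l) ^ 2` is the commutator of `l` and `r
    -- l r`.
    have := commutator_mem (leftAt n I v) (rightAt n I v * leftAt n I v * rightAt n I v)
    simpa only [backAt, outAt, pow_two, mul_assoc] using this

/-! ### Derivatives along a loop -/

theorem polarDerivative_loop_rightAt {n : ℕ} {I : Finset ℕ} (v : Vertex n I) (hv : v.1 ∉ I)
    (u : ℕ) (g : CompletePathAlgebra ℂ (Vertex n I)) :
    polarDerivative (i := v) (j := v) (Arrow.loop v hv) (rightAt n I u) g = 0 := by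
  unfold rightAt
  split_ifs with h
  · refine polarDerivative_arrow_of_ne (fun h' => ?_) g
    cases h'
  · rw [map_zero, LinearMap.zero_apply]

theorem polarDerivative_loop_leftAt {n : ℕ} {I : Finset ℕ} (v : Vertex n I) (hv : v.1 ∉ I)
    (u : ℕ) (g : CompletePathAlgebra ℂ (Vertex n I)) :
    polarDerivative (i := v) (j := v) (Arrow.loop v hv) (leftAt n I u) g = 0 := by
  unfold leftAt
  split_ifs with h
  · refine polarDerivative_arrow_of_ne (fun h' => ?_) g
    cases h'
  · rw [map_zero, LinearMap.zero_apply]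

theorem polarDerivative_loop_outAt (v : Vertex n I) (hv : v.1 ∉ I)
    (u : ℕ) (g : CompletePathAlgebra ℂ (Vertex n I)) :
    polarDerivative (i := v) (j := v) (Arrow.loop v hv) (outAt n I u) g = 0 := by
  rw [outAt, polarDerivative_mul, polarDerivative_loop_leftAt, polarDerivative_loop_rightAt,
    add_zero]

theorem polarDerivative_loop_backAt (v : Vertex n I) (hv : v.1 ∉ I)
    (u : ℕ) (g : CompletePathAlgebra ℂ (Vertex n I)) :
    polarDerivative (i := v) (j := v) (Arrow.loop v hv) (backAt n I u) g = 0 := by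
  rw [backAt, polarDerivative_mul, polarDerivative_loop_leftAt, polarDerivative_loop_rightAt,
    add_zero]

theorem polarDerivative_loop_loopAt (v : Vertex n I) (hv : v.1 ∉ I)
    (g : CompletePathAlgebra ℂ (Vertex n I)) :
    polarDerivative (i := v) (j := v) (Arrow.loop v hv) (loopAt n I v.1) g =
      lazy ℂ v * g * lazy ℂ v := by
  rw [loopAt_coe v hv]
  exact polarDerivative_arrow_self _ _

theorem polarDerivative_loop_loopAt_of_ne (v : Vertex n I) (hv : v.1 ∉ I) {u : ℕ} (hu : u ≠ v.1)
    (g : CompletePathAlgebra ℂ (Vertex n I)) :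
    polarDerivative (i := v) (j := v) (Arrow.loop v hv) (loopAt n I u) g = 0 := by
  unfold loopAt
  split_ifs with h
  · refine polarDerivative_arrow_of_ne (fun h' => hu ?_) g
    exact (congrArg (fun s : Σ i j : Vertex n I, (i ⟶ j) => s.1.1) h').symm
  · rw [map_zero, LinearMap.zero_apply]

/-- The cyclic derivative along a loop where the potential is quadratic. -/
theorem cyclicDerivative_loop_monomialPotential (κ : ℕ → ℕ → ℂ) (v : Vertex n ∅)
    (hκ : κ (2 * v.1 - 1) = quadratic (-(1 / 2))) :
    cyclicDerivative (i := v) (j := v) (Arrow.loop v (Finset.notMem_empty _))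
      (monomialPotential n ∅ κ) =
        backAt n ∅ (v.1 - 1) + outAt n ∅ v.1 - loopAt n ∅ v.1 := by
  have hv := Finset.mem_Icc.1 v.2
  let a : v ⟶ v := Arrow.loop v (Finset.notMem_empty _)
  have h₁ : ∀ u, polarDerivative a (loopAt n ∅ u * outAt n ∅ u) 1 =
      if u = v.1 then outAt n ∅ v.1 else 0 := by
    intro u
    rw [polarDerivative_mul, polarDerivative_loop_outAt, add_zero, mul_one]
    split_ifs with hu
    · rw [hu, polarDerivative_loop_loopAt, lazy_mul_outAt, outAt_mul_lazy]
    · rw [polarDerivative_loop_loopAt_of_ne v _ hu]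
  have h₂ : ∀ u, polarDerivative a (backAt n ∅ u * loopAt n ∅ (u + 1)) 1 =
      if u = v.1 - 1 then backAt n ∅ (v.1 - 1) else 0 := by
    intro u
    rw [polarDerivative_mul, polarDerivative_loop_backAt, zero_add, one_mul]
    split_ifs with hu
    · rw [hu, show v.1 - 1 + 1 = v.1 by omega, polarDerivative_loop_loopAt, lazy_mul_backAt,
        backAt_mul_lazy]
    · rw [polarDerivative_loop_loopAt_of_ne v _ (by omega)]
  have h₃ : ∀ u, polarDerivative a (seriesFromTwo (κ (2 * u - 1)) (loopAt n ∅ u)) 1 =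
      if u = v.1 then -loopAt n ∅ v.1 else 0 := by
    intro u
    split_ifs with hu
    · rw [hu, hκ, seriesFromTwo_quadratic _ (loopAt_agreeBelow _), map_smul, LinearMap.smul_apply,
        pow_two, polarDerivative_mul, mul_one, one_mul, polarDerivative_loop_loopAt,
        lazy_mul_loopAt, loopAt_mul_lazy]
      module
    · rw [← cyclicDerivative_eq]
      exact cyclicDerivative_seriesFromTwo_eq_zero (loopAt_agreeBelow u)
        (polarDerivative_loop_loopAt_of_ne v _ hu) _
  have h₄ : ∀ u, polarDerivative a (seriesFromTwo (κ (2 * u)) (outAt n ∅ u)) 1 = 0 := by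
    intro u
    rw [← cyclicDerivative_eq]
    exact cyclicDerivative_seriesFromTwo_eq_zero (outAt_agreeBelow u)
      (polarDerivative_loop_outAt v _ u) _
  change cyclicDerivative a _ = _
  rw [monomialPotential_empty, cyclicDerivative_eq, map_sum, LinearMap.sum_apply]
  simp only [map_add, LinearMap.add_apply, h₁, h₂, h₃, h₄, Finset.sum_add_distrib,
    Finset.sum_ite_eq', add_zero]
  rw [if_pos v.2, if_pos v.2]
  -- If `v = 1`, no summand has index `v - 1`, in accordance with the value zero of `backAt` at `0`.
  by_cases h : v.1 - 1 ∈ Finset.Icc 1 n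
  · rw [if_pos h]
    abel
  · rw [if_neg h, backAt_of_notMem fun h' => h h'.1]
    abel

/-! ### The inclusion of the path algebra of `Q_{n,I}` into that of `Q_n` -/

theorem algHom_embedding_rightAt (v : ℕ) :
    ((elimination n I).embedding arrowInclusion).algHom (rightAt n I v) = rightAt n ∅ v := by
  by_cases h : v ∈ Finset.Icc 1 n ∧ v + 1 ∈ Finset.Icc 1 n
  · obtain ⟨v, rfl⟩ : ∃ v' : Vertex n I, v'.1 = v := ⟨⟨v, h.1⟩, rfl⟩
    obtain ⟨w, hw⟩ : ∃ w : Vertex n I, v.1 + 1 = w.1 := ⟨⟨v.1 + 1, h.2⟩, rfl⟩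
    rw [rightAt_coe v w hw, Substitution.algHom_arrow]
    exact (rightAt_coe (vertexEquiv n I ∅ v) (vertexEquiv n I ∅ w) hw).symm
  · rw [rightAt_of_notMem h, rightAt_of_notMem h, map_zero]

theorem algHom_embedding_leftAt (v : ℕ) :
    ((elimination n I).embedding arrowInclusion).algHom (leftAt n I v) = leftAt n ∅ v := by
  by_cases h : v ∈ Finset.Icc 1 n ∧ v + 1 ∈ Finset.Icc 1 n
  · obtain ⟨v, rfl⟩ : ∃ v' : Vertex n I, v'.1 = v := ⟨⟨v, h.1⟩, rfl⟩
    obtain ⟨w, hw⟩ : ∃ w : Vertex n I, v.1 + 1 = w.1 := ⟨⟨v.1 + 1, h.2⟩, rfl⟩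
    rw [leftAt_coe v w hw, Substitution.algHom_arrow]
    exact (leftAt_coe (vertexEquiv n I ∅ v) (vertexEquiv n I ∅ w) hw).symm
  · rw [leftAt_of_notMem h, leftAt_of_notMem h, map_zero]

theorem algHom_embedding_outAt (v : ℕ) :
    ((elimination n I).embedding arrowInclusion).algHom (outAt n I v) = outAt n ∅ v := by
  rw [outAt, map_mul, algHom_embedding_rightAt, algHom_embedding_leftAt, outAt]

theorem algHom_embedding_backAt (v : ℕ) :
    ((elimination n I).embedding arrowInclusion).algHom (backAt n I v) = backAt n ∅ v := by
  rw [backAt, map_mul, algHom_embedding_rightAt, algHom_embedding_leftAt, backAt]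

theorem elimination_image_inclusion {v w : Vertex n I} (a : v ⟶ w) :
    (elimination n I).image (arrowInclusion a) = arrow ℂ a := by
  obtain ⟨_, hv⟩ | ⟨_, _, h⟩ | ⟨_, _, h⟩ := a
  · change loopImage n I v.1 = _
    rw [loopImage, if_neg hv, loopAt_coe v hv]
  · exact rightAt_coe v w h
  · exact leftAt_coe w v h

end TypeA

/-! ### The proposition -/

theorem proposition4p10 (n : ℕ) (I : Finset ℕ) (hI : I ⊆ Finset.Icc 1 n)
    (f : CompletePathAlgebra ℂ (TypeA.Vertex n I)) (hf : TypeA.IsMonomializedTypeA n I f) :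
    ∃ κ : ℕ → ℕ → ℂ,
      Nonempty (CompletePathAlgebra.JacobiAlgebra (TypeA.monomialPotential n ∅ κ) ≃ₐ[ℂ]
        CompletePathAlgebra.JacobiAlgebra f) ∧
      ∀ i ∈ I, κ (2 * i - 1) 2 ≠ 0 := by
  open TypeA CompletePathAlgebra in
  obtain ⟨-, κ, hκ⟩ := hf
  refine ⟨liftedCoeff n I κ, ?_, fun i hi => ?_⟩
  · refine nonempty_jacobiAlgebra_algEquiv (elimination n I) arrowInclusion
      elimination_image_inclusion (hκ.of_sub_mem (algHom_lifted_sub_mem hI κ)) ?_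
    rintro v w (⟨_, hv⟩ | ⟨_, _, h⟩ | ⟨_, _, h⟩)
    · by_cases hvI : v.1 ∈ I
      · right
        have hd := cyclicDerivative_loop_monomialPotential (liftedCoeff n I κ) v
          (by rw [liftedCoeff_loop κ (Finset.mem_Icc.1 v.2).1, if_pos hvI])
        constructor
        -- The substitution sends `b + o - a` to `(b + o) - (b + o)`.
        · rw [hd, map_sub, map_add, algHom_backAt, algHom_outAt, algHom_loopAt hI, loopImage,
            if_pos hvI, sub_self]
        -- Here the difference of `b + o` and `a` is itself the cyclic derivative along `a`, hence
        -- in the Jacobi ideal.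
        · change ((elimination n I).embedding arrowInclusion).algHom (loopImage n I v.1) - _ ∈ _
          rw [loopImage, if_pos hvI, map_add, algHom_embedding_backAt, algHom_embedding_outAt,
            ← loopAt_coe v hv, ← hd]
          exact cyclicDerivative_mem_jacobiIdeal _ _
      · exact Or.inl ⟨_, _, Arrow.loop (vertexEquiv n ∅ I v) hvI, rfl⟩
    · exact Or.inl ⟨_, _, Arrow.right (vertexEquiv n ∅ I v) (vertexEquiv n ∅ I w) h, rfl⟩
    · exact Or.inl ⟨_, _, Arrow.left (vertexEquiv n ∅ I w) (vertexEquiv n ∅ I v) h, rfl⟩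
  · rw [liftedCoeff_loop κ (Finset.mem_Icc.1 (hI hi)).1, if_pos hi]
    norm_num [quadratic]
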